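/- Theorem 2.2. Let $g>0$, $\rho_+>\rho_->0$, $\mu_\pm>0$, $B\in\mathbb R\setminus\{0\}$, and put $[\rho]=\rho_+-\rho_-$. Let $\rho,\mu$ denote the functions on $(-1,0)\cup(0,1)$ equal to $\rho_-,\mu_-$ on $(-1,0)$ and to $\rho_+,\mu_+$ on $(0,1)$, and write $\llbracket f\rrbracket=f(0^+)-f(0^-)$. Define the critical magnetic number $|B|_c\ge 0$ and the critical frequency $|\xi|_{hc}^B\ge0$ by $$|B|_c^2=\sup_{0\ne\psi\in H_0^1((-1,1))}\frac{g[\rho]\psi(0)^2}{\int_{-1}^1|\psi'|^2\,dx_2},\qquad (|\xi|_{hc}^B)^2=\sup_{0\ne\psi\in H_0^1((-1,1))}\frac{g[\rho]\psi(0)^2-|B|^2\int_{-1}^1|\psi'|^2\,dx_2}{|B|^2\int_{-1}^1|\psi|^2\,dx_2},$$ the second one being used only for $|B|<|B|_c$. For $\xi\in\mathbb R$ consider the normal-mode problem for the horizontal magnetic field $\bar B=(B,0)$ in dimension two, with unknowns $\lambda>0$ and a real function $\psi=\psi(x_2)$ on $[-1,1]$: $$-\lambda^2\rho(|\xi|^2\psi-\psi'')=\mu\lambda(|\xi|^4\psi-2|\xi|^2\psi''+\psi'''')+|B|^2(|\xi|^4\psi-|\xi|^2\psi'')\quad\text{on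 }(-1,0)\text{ and }(0,1),$$ $$\llbracket\psi\rrbracket=\llbracket\psi'\rrbracket=0,\qquad \llbracket\mu\lambda(|\xi|^2\psi+\psi'')\rrbracket=0,\qquad \llbracket\mu\lambda(\psi'''-3|\xi|^2\psi')\rrbracket=\llbracket\lambda^2\rho\psi'\rrbracket+g[\rho]|\xi|^2\psi(0),$$ $$\psi(-1)=\psi(1)=\psi'(-1)=\psi'(1)=0.$$ (i) If $|B|\ge|B|_c$, then for every $\xi\in\mathbb R$ the problem has no solution with $\lambda>0$ and $\psi\not\equiv0$. (ii) If $|B|<|B|_c$, then for every $\xi\in\mathbb R$ with $|\xi|\ge|\xi|_{hc}^B$ the problem has no solution with $\lambda>0$ and $\psi\not\equiv0$. (iii) If $|B|<|B|_c$, then for every $\xi\in\mathbb R$ with $0<|\xi|<|\xi|_{hc}^B$ there is a solution $\lambda=\lambda(\xi)>0$, $\psi=\psi(\xi,\cdot)$ of the problem; these solutions can be chosen so that $\lambda(\xi)$ and $\psi(\xi,\cdot)$ are even in $\xi$, and $\psi(\xi,\cdot)$ is smooth on $(-1,0)$ and on $(0,1)$ with $\psi(\xi,0)\neq0$. -/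

import Mathlib

open Set Filter Topology MeasureTheory
open scoped ContDiff

namespace RayleighTaylorMHD

noncomputable section

/-- A quantity equal to the constant `aPlus` in the upper fluid `x₂ > 0` and to `aMinus` in the
lower fluid `x₂ < 0` (the value on the interface `x₂ = 0` is never used). -/
def twoPhase (aPlus aMinus : ℝ) (x : ℝ) : ℝ := if 0 < x then aPlus else aMinus

/-- The interfacial jump `⟦f⟧ = f₊(0) - f₋(0)` exists (both one-sided traces exist) and equals
`J`. -/
def HasJump (f : ℝ → ℝ) (J : ℝ) : Prop :=
  ∃ a b : ℝ, Tendsto f (𝓝[>] 0) (𝓝 a) ∧ Tendsto f (𝓝[<] 0) (𝓝 b) ∧ J = a - b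

/-- `φ` is the weak derivative of `ψ` on the interval `(-1,1)`. -/
def IsWeakDeriv (ψ φ : ℝ → ℝ) : Prop :=
  ∀ η : ℝ → ℝ, ContDiff ℝ ∞ η → HasCompactSupport η → tsupport η ⊆ Ioo (-1) 1 →
    ∫ x in Ioo (-1 : ℝ) 1, ψ x * deriv η x = -∫ x in Ioo (-1 : ℝ) 1, φ x * η x

/-- `ψ` is (the continuous representative of) an element of `H¹₀((-1,1))`, and `φ` is its weak
derivative. In one dimension every element of `H¹` has a unique representative that is continuous
on `[-1,1]`, so the values `ψ(0)`, `ψ(±1)` are those of this representative. -/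
structure IsH10 (ψ φ : ℝ → ℝ) : Prop where
  continuousOn : ContinuousOn ψ (Icc (-1) 1)
  memLp : MemLp φ 2 (volume.restrict (Ioo (-1) 1))
  weakDeriv : IsWeakDeriv ψ φ
  left : ψ (-1) = 0
  right : ψ 1 = 0

/-- The function `ψ` is not identically zero on `(-1,1)`. -/
def Nontriv (ψ : ℝ → ℝ) : Prop := ∃ x ∈ Ioo (-1 : ℝ) 1, ψ x ≠ 0

/-- The critical magnetic number `|B|_c ≥ 0`, where `|B|_c²` is the supremum of
`g[ρ] ψ(0)² / ∫ |ψ'|²` over the nonzero `ψ ∈ H¹₀((-1,1))`. The argument `jρ` is `[ρ] = ρ₊ - ρ₋`. -/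
def criticalB (g jρ : ℝ) : ℝ :=
  √(sSup {q : ℝ | ∃ ψ φ : ℝ → ℝ, IsH10 ψ φ ∧ Nontriv ψ ∧
    q = g * jρ * ψ 0 ^ 2 / ∫ x in Ioo (-1 : ℝ) 1, φ x ^ 2})

/-- The critical frequency `|ξ|_{hc}^B ≥ 0` for the horizontal magnetic number, whose square is the
supremum of `(g[ρ] ψ(0)² - |B|² ∫ |ψ'|²) / (|B|² ∫ |ψ|²)` over the nonzero `ψ ∈ H¹₀((-1,1))`. -/
def criticalFreqH (g jρ B : ℝ) : ℝ :=
  √(sSup {q : ℝ | ∃ ψ φ : ℝ → ℝ, IsH10 ψ φ ∧ Nontriv ψ ∧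
    q = (g * jρ * ψ 0 ^ 2 - |B| ^ 2 * ∫ x in Ioo (-1 : ℝ) 1, φ x ^ 2) /
      (|B| ^ 2 * ∫ x in Ioo (-1 : ℝ) 1, ψ x ^ 2)})

/-- `(lam, ψ)` solves (classically in each fluid) the two-dimensional normal-mode problem with
horizontal magnetic number `(B,0)` at the frequency `ξ`. -/
structure IsNormalMode (g ρp ρm μp μm B ξ lam : ℝ) (ψ : ℝ → ℝ) : Prop where
  /-- `ψ` is a function on `[-1,1]`, continuous across the interface: `⟦ψ⟧ = 0`. -/
  continuousOn : ContinuousOn ψ (Icc (-1) 1)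
  contDiffOn_lower : ContDiffOn ℝ 4 ψ (Ioo (-1) 0)
  contDiffOn_upper : ContDiffOn ℝ 4 ψ (Ioo 0 1)
  /-- The fourth-order equation in both fluids. -/
  ode : ∀ x ∈ Ioo (-1 : ℝ) 0 ∪ Ioo 0 1,
    -lam ^ 2 * twoPhase ρp ρm x * (|ξ| ^ 2 * ψ x - iteratedDeriv 2 ψ x) =
      twoPhase μp μm x * lam *
        (|ξ| ^ 4 * ψ x - 2 * |ξ| ^ 2 * iteratedDeriv 2 ψ x + iteratedDeriv 4 ψ x) +
      |B| ^ 2 * (|ξ| ^ 2 * ξ ^ 2 * ψ x - ξ ^ 2 * iteratedDeriv 2 ψ x)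
  /-- `⟦ψ'⟧ = 0`. -/
  jump_deriv : HasJump (deriv ψ) 0
  /-- `⟦μ λ (|ξ|² ψ + ψ'')⟧ = 0`. -/
  jump_two : HasJump
    (fun x => twoPhase μp μm x * lam * (|ξ| ^ 2 * ψ x + iteratedDeriv 2 ψ x)) 0
  /-- `⟦μ λ (ψ''' - 3 |ξ|² ψ')⟧ = ⟦λ² ρ ψ'⟧ + g [ρ] |ξ|² ψ(0)`. -/
  jump_three : ∃ J : ℝ, HasJump (fun x => lam ^ 2 * twoPhase ρp ρm x * deriv ψ x) J ∧
    HasJump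
      (fun x => twoPhase μp μm x * lam * (iteratedDeriv 3 ψ x - 3 * |ξ| ^ 2 * deriv ψ x))
      (J + g * (ρp - ρm) * |ξ| ^ 2 * ψ 0)
  left : ψ (-1) = 0
  right : ψ 1 = 0
  /-- `ψ'(-1) = 0`, as a one-sided trace. -/
  deriv_left : Tendsto (deriv ψ) (𝓝[>] (-1)) (𝓝 0)
  /-- `ψ'(1) = 0`, as a one-sided trace. -/
  deriv_right : Tendsto (deriv ψ) (𝓝[<] 1) (𝓝 0)

end

end RayleighTaylorMHD

/-!
On each fluid layer the equation has constant coefficients, so `ψ` is there the restriction of a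
smooth function on the line, and the problem becomes one for pairs of smooth functions. Integrating
by parts, a pair solves it at the growth rate `l` and the frequency `k` exactly when it is the
response `u` to the interfacial force `c = g[ρ]k²u(0)`, and then
`l² R(u, v) + l M(u, v) + B²k² K(u, v) = c v(0)` with positive semidefinite inertial, viscous and
magnetic forms, `K(u, u) = ∫ u'² + k² ∫ u²`. For `v = u` the first two terms are nonnegative, the
first even positive, so `B² K(u, u) < g[ρ]u(0)²`: this contradicts the definition of either critical
number beyond its threshold. Conversely let `u_l` be the response to the unit force, which exists by
uniqueness since the boundary conditions are as many as the parameters. Then `u_l(0)` is the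
supremum of `v(0)² / (l² R + l M + B²k² K)(v, v)`, so it is continuous and decreasing in `l`. Below
the critical frequency `g[ρ]k²u_l(0)` exceeds `1` for small `l`, and it is at most `1` for large
`l`; where it equals `1`, `u_l` is a normal mode.
-/

open scoped Distributions

namespace RayleighTaylorMHD

noncomputable section

theorem integral_Ioo_eq (f : ℝ → ℝ) {a b : ℝ} (hab : a ≤ b) :
    ∫ x in Ioo a b, f x = ∫ x in a..b, f x := by
  rw [intervalIntegral.integral_of_le hab, integral_Ioc_eq_integral_Ioo]

theorem hasDerivAt_primitive {f : ℝ → ℝ} (hf : Continuous f) (a x : ℝ) :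
    HasDerivAt (fun x => ∫ t in a..x, f t) (f x) x :=
  intervalIntegral.integral_hasDerivAt_right (hf.intervalIntegrable _ _)
    (hf.stronglyMeasurableAtFilter _ _) hf.continuousAt

theorem contDiff_primitive {f : ℝ → ℝ} (hf : ContDiff ℝ ∞ f) (a : ℝ) :
    ContDiff ℝ ∞ (fun x => ∫ t in a..x, f t) := by
  have hd := hasDerivAt_primitive hf.continuous a
  refine contDiff_infty_iff_deriv.2 ⟨fun x => (hd x).differentiableAt, ?_⟩
  rwa [funext fun x => (hd x).deriv]

/-- The interval `(a, b)` as an open set, the domain of the test functions `𝓓(ioo a b, ℝ)`. -/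
def ioo (a b : ℝ) : TopologicalSpace.Opens ℝ := ⟨Ioo a b, isOpen_Ioo⟩

section TestFunctions

variable {a b : ℝ} {f : ℝ → ℝ}

theorem testFunction_apply_eq_zero (η : 𝓓(ioo a b, ℝ)) {x : ℝ} (hx : x ∉ Ioo a b) : η x = 0 :=
  image_eq_zero_of_notMem_tsupport fun h => hx (η.tsupport_subset h)

theorem testFunction_integrable (η : 𝓓(ioo a b, ℝ)) : Integrable η :=
  η.continuous.integrable_of_hasCompactSupport η.hasCompactSupport

theorem setIntegral_testFunction (η : 𝓓(ioo a b, ℝ)) : ∫ x in Ioo a b, η x = ∫ x, η x :=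
  setIntegral_eq_integral_of_forall_compl_eq_zero fun _ => testFunction_apply_eq_zero η

theorem integrableOn_mul_testFunction (hf : IntegrableOn f (Ioo a b)) (η : 𝓓(ioo a b, ℝ)) :
    IntegrableOn (fun x => f x * η x) (Ioo a b) := by
  obtain ⟨C, hC⟩ := η.hasCompactSupport.exists_bound_of_continuous η.continuous
  exact hf.mul_bdd η.continuous.aestronglyMeasurable (.of_forall hC)

open LineDeriv in
theorem coe_lineDerivOp_one (η : 𝓓(ioo a b, ℝ)) :
    ⇑(∂_{(1 : ℝ)} η : 𝓓(ioo a b, ℝ)) = deriv η := by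
  ext x
  simp [TestFunction.lineDerivOp_eq_lineDerivCLM ℝ, lineDeriv, deriv_comp_const_add]

theorem exists_tsupport_subset_Icc (hab : a < b) (η : 𝓓(ioo a b, ℝ)) :
    ∃ c d, a < c ∧ d < b ∧ tsupport η ⊆ Icc c d := by
  set K := insert ((a + b) / 2) (tsupport η)
  have hK : IsCompact K := η.hasCompactSupport.isCompact.insert _
  have hKne : K.Nonempty := insert_nonempty _ _
  have hKab : K ⊆ Ioo a b :=
    insert_subset ⟨by linarith, by linarith⟩ η.tsupport_subset
  exact ⟨sInf K, sSup K, (hKab (hK.sInf_mem hKne)).1, (hKab (hK.sSup_mem hKne)).2,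
    (subset_insert _ _).trans (subset_Icc_csInf_csSup hK.bddBelow hK.bddAbove)⟩

theorem exists_testFunction_deriv_eq (hab : a < b) (θ : 𝓓(ioo a b, ℝ)) (hθ : ∫ x, θ x = 0) :
    ∃ η : 𝓓(ioo a b, ℝ), deriv η = θ := by
  obtain ⟨c, d, hac, hdb, hcd⟩ := exists_tsupport_subset_Icc hab θ
  have hout : ∀ x, x ∉ Icc c d → θ x = 0 := fun x hx =>
    image_eq_zero_of_notMem_tsupport fun h => hx (hcd h)
  have hsupp : ∀ x, x ∉ Icc c d → ∫ t in a..x, θ t = 0 := fun x hx => by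
    rcases not_and_or.1 hx with hx | hx
    · refine intervalIntegral.integral_zero_ae (.of_forall fun t ht => hout t fun h => ?_)
      exact (h.1.trans ht.2).not_gt (max_lt hac (not_le.1 hx))
    · rw [← hθ, ← setIntegral_testFunction, integral_Ioo_eq _ hab.le, eq_comm, ← sub_eq_zero,
        intervalIntegral.integral_interval_sub_left (θ.continuous.intervalIntegrable _ _)
          (θ.continuous.intervalIntegrable _ _)]
      refine intervalIntegral.integral_zero_ae (.of_forall fun t ht => hout t fun h => ?_)
      exact (ht.1.trans_le h.2).not_gt (lt_min (not_le.1 hx) hdb)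
  have htsupp : tsupport (fun x => ∫ t in a..x, θ t) ⊆ Icc c d :=
    closure_minimal (fun x hx => by_contra fun h => hx (hsupp x h)) isClosed_Icc
  exact ⟨⟨_, contDiff_primitive θ.contDiff a,
    .of_support_subset_isCompact isCompact_Icc ((subset_tsupport _).trans htsupp),
    htsupp.trans (Icc_subset_Ioo hac hdb)⟩,
    funext fun x => (hasDerivAt_primitive θ.continuous a x).deriv⟩

theorem exists_testFunction_integral_eq_one (hab : a < b) :
    ∃ η : 𝓓(ioo a b, ℝ), ∫ x, η x = 1 := by
  let β : ContDiffBump ((a + b) / 2) := ⟨(b - a) / 4, (b - a) / 3, by linarith, by linarith⟩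
  refine ⟨⟨β.normed volume, β.contDiff_normed, β.hasCompactSupport_normed, ?_⟩,
    β.integral_normed⟩
  rw [β.tsupport_normed_eq, Real.closedBall_eq_Icc]
  have hβ : β.rOut = (b - a) / 3 := rfl
  exact Icc_subset_Ioo (by linarith) (by linarith)

theorem integral_mul_testFunction_of_integral_mul_deriv_eq_zero (hab : a < b)
    (hf : IntegrableOn f (Ioo a b))
    (h : ∀ η : 𝓓(ioo a b, ℝ), ∫ x in Ioo a b, f x * deriv η x = 0) :
    ∃ c : ℝ, ∀ η : 𝓓(ioo a b, ℝ), ∫ x in Ioo a b, f x * η x = c * ∫ x, η x := by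
  obtain ⟨η₀, hη₀⟩ := exists_testFunction_integral_eq_one hab
  refine ⟨∫ x in Ioo a b, f x * η₀ x, fun η => ?_⟩
  set s := ∫ x, η x
  have hmean : ∫ x, (η - s • η₀) x = 0 := by
    simp only [sub_apply, smul_apply, smul_eq_mul]
    rw [integral_sub (testFunction_integrable η) ((testFunction_integrable η₀).const_mul s),
      integral_const_mul, hη₀, mul_one, sub_self]
  obtain ⟨χ, hχ⟩ := exists_testFunction_deriv_eq hab _ hmean
  have hzero : ∫ x in Ioo a b, (f x * η x - s * (f x * η₀ x)) = 0 := by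
    refine Eq.trans (integral_congr_ae (.of_forall fun x => ?_)) (h χ)
    simp only [hχ, sub_apply, smul_apply, smul_eq_mul]
    ring
  rw [integral_sub (integrableOn_mul_testFunction hf η)
    ((integrableOn_mul_testFunction hf η₀).const_mul s), integral_const_mul] at hzero
  linarith

/-- The lemma of du Bois-Reymond. -/
theorem ae_eq_const_of_integral_mul_deriv_eq_zero (hab : a < b) (hf : IntegrableOn f (Ioo a b))
    (h : ∀ η : 𝓓(ioo a b, ℝ), ∫ x in Ioo a b, f x * deriv η x = 0) :
    ∃ c : ℝ, ∀ᵐ x ∂volume.restrict (Ioo a b), f x = c := by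
  obtain ⟨c, hc⟩ := integral_mul_testFunction_of_integral_mul_deriv_eq_zero hab hf h
  have hfc : IntegrableOn (fun x => f x - c) (Ioo a b) := hf.sub (integrableOn_const (by simp))
  have hae := isOpen_Ioo.ae_eq_zero_of_integral_contDiff_smul_eq_zero hfc.locallyIntegrableOn
    fun η h₁ h₂ h₃ => by
      let θ : 𝓓(ioo a b, ℝ) := ⟨η, h₁, h₂, h₃⟩
      calc ∫ x, θ x • (f x - c) = ∫ x in Ioo a b, θ x • (f x - c) :=
            (setIntegral_eq_integral_of_forall_compl_eq_zero fun x hx => by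
              rw [testFunction_apply_eq_zero θ hx, zero_smul]).symm
        _ = ∫ x in Ioo a b, (f x * θ x - c * θ x) := by
            congr! 2 with x
            simp only [smul_eq_mul]
            ring
        _ = 0 := by
            rw [integral_sub (integrableOn_mul_testFunction hf θ)
              ((testFunction_integrable θ).integrableOn.const_mul c), integral_const_mul, hc,
              setIntegral_testFunction, sub_self]
  refine ⟨c, (ae_restrict_iff' measurableSet_Ioo).2 ?_⟩
  filter_upwards [hae] with x hx hxab using sub_eq_zero.1 (hx hxab)

end TestFunctions

section SquareIntegrable

variable {α : Type*} [MeasurableSpace α] {μ : Measure α} {f g : α → ℝ}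

theorem inner_toLp (hf : MemLp f 2 μ) (hg : MemLp g 2 μ) :
    inner ℝ (hf.toLp f) (hg.toLp g) = ∫ x, f x * g x ∂μ := by
  rw [L2.inner_def]
  refine integral_congr_ae ?_
  filter_upwards [hf.coeFn_toLp, hg.coeFn_toLp] with x hfx hgx
  simp only [hfx, hgx, RCLike.inner_apply, conj_trivial, mul_comm]

theorem norm_toLp_sq (hf : MemLp f 2 μ) : ‖hf.toLp f‖ ^ 2 = ∫ x, f x ^ 2 ∂μ := by
  simp_rw [← real_inner_self_eq_norm_sq, inner_toLp, sq]

theorem sq_integral_mul_le (hf : MemLp f 2 μ) (hg : MemLp g 2 μ) :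
    (∫ x, f x * g x ∂μ) ^ 2 ≤ (∫ x, f x ^ 2 ∂μ) * ∫ x, g x ^ 2 ∂μ := by
  simpa only [inner_toLp, ← sq] using real_inner_mul_inner_self_le (hf.toLp f) (hg.toLp g)

theorem tendsto_integral_sq {ι : Type*} {l : Filter ι} {g : ι → α → ℝ} (hf : MemLp f 2 μ)
    (hg : ∀ i, MemLp (g i) 2 μ) (h : Tendsto (fun i => ∫ x, (f x - g i x) ^ 2 ∂μ) l (𝓝 0)) :
    Tendsto (fun i => ∫ x, g i x ^ 2 ∂μ) l (𝓝 (∫ x, f x ^ 2 ∂μ)) := by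
  have hdist : ∀ i, dist ((hg i).toLp (g i)) (hf.toLp f) = √(∫ x, (f x - g i x) ^ 2 ∂μ) :=
    fun i => by
      rw [dist_comm, dist_eq_norm, ← MemLp.toLp_sub, ← Real.sqrt_sq (norm_nonneg _), norm_toLp_sq]
      rfl
  have hlim : Tendsto (fun i => (hg i).toLp (g i)) l (𝓝 (hf.toLp f)) := by
    rw [tendsto_iff_dist_tendsto_zero, funext hdist, ← Real.sqrt_zero]
    exact h.sqrt
  simpa only [norm_toLp_sq] using hlim.norm.pow 2

end SquareIntegrable

section Density

variable {a b : ℝ} {φ : ℝ → ℝ}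

theorem memLp_testFunction (η : 𝓓(ioo a b, ℝ)) : MemLp η 2 (volume.restrict (Ioo a b)) :=
  (η.continuous.memLp_of_hasCompactSupport η.hasCompactSupport).restrict _

theorem memLp_deriv_testFunction (η : 𝓓(ioo a b, ℝ)) :
    MemLp (deriv η) 2 (volume.restrict (Ioo a b)) := by
  rw [← coe_lineDerivOp_one]
  exact memLp_testFunction _

/-- Differentiation of test functions on `(a, b)`, with values in `L²(a, b)`. -/
def testDeriv (a b : ℝ) : 𝓓(ioo a b, ℝ) →ₗ[ℝ] Lp ℝ 2 (volume.restrict (Ioo a b)) where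
  toFun η := (memLp_deriv_testFunction η).toLp (deriv η)
  map_add' η θ := by
    rw [← MemLp.toLp_add]
    congr
    ext x
    simp only [← coe_lineDerivOp_one, LineDeriv.lineDerivOp_add, add_apply, Pi.add_apply]
  map_smul' c η := by
    rw [RingHom.id_apply, ← MemLp.toLp_const_smul]
    congr
    ext x
    simp only [← coe_lineDerivOp_one, LineDeriv.lineDerivOp_smul, smul_apply, Pi.smul_apply]

theorem toLp_mem_closure_range_testDeriv (hab : a < b)
    (hφ : MemLp φ 2 (volume.restrict (Ioo a b))) (h0 : ∫ x in Ioo a b, φ x = 0) :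
    hφ.toLp φ ∈ (testDeriv a b).range.topologicalClosure := by
  rw [← Submodule.orthogonal_orthogonal_eq_closure, Submodule.mem_orthogonal]
  intro f hf
  have hfL := Lp.memLp f
  have hf_toLp : f = hfL.toLp f := (Lp.toLp_coeFn f hfL).symm
  obtain ⟨c, hc⟩ := ae_eq_const_of_integral_mul_deriv_eq_zero hab (hfL.integrable one_le_two)
    fun η => by
      rw [← inner_toLp hfL (memLp_deriv_testFunction η), ← hf_toLp]
      exact (Submodule.mem_orthogonal' _ f).1 hf _ ⟨η, rfl⟩
  calc inner ℝ f (hφ.toLp φ) = ∫ x in Ioo a b, f x * φ x := by rw [← inner_toLp hfL, ← hf_toLp]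
    _ = ∫ x in Ioo a b, c * φ x := integral_congr_ae (hc.mono fun x hx => by simp only [hx])
    _ = 0 := by rw [integral_const_mul, h0, mul_zero]

theorem exists_seq_testFunction_tendsto (hab : a < b)
    (hφ : MemLp φ 2 (volume.restrict (Ioo a b))) (h0 : ∫ x in Ioo a b, φ x = 0) :
    ∃ χ : ℕ → 𝓓(ioo a b, ℝ),
      Tendsto (fun n => ∫ x in Ioo a b, (φ x - deriv (χ n) x) ^ 2) atTop (𝓝 0) := by
  obtain ⟨u, hu, hlim⟩ := mem_closure_iff_seq_limit.1 (toLp_mem_closure_range_testDeriv hab hφ h0)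
  choose χ hχ using hu
  refine ⟨χ, ?_⟩
  have hnorm : ∀ n, ∫ x in Ioo a b, (φ x - deriv (χ n) x) ^ 2 = ‖hφ.toLp φ - u n‖ ^ 2 :=
    fun n => by
      rw [← hχ n, testDeriv, LinearMap.coe_mk, AddHom.coe_mk, ← MemLp.toLp_sub, norm_toLp_sq]
      rfl
  simpa [hnorm] using (hlim.const_sub (hφ.toLp φ)).norm.pow 2

end Density

section Primitives

variable {a b : ℝ} {f g : ℝ → ℝ}

theorem memLp_two_of_continuousOn (hf : ContinuousOn f (Icc a b)) :
    MemLp f 2 (volume.restrict (Ioo a b)) :=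
  (memLp_two_iff_integrable_sq ((hf.mono Ioo_subset_Icc_self).aestronglyMeasurable
    measurableSet_Ioo)).2 ((hf.pow 2).integrableOn_Icc.mono_set Ioo_subset_Icc_self)

theorem intervalIntegrable_of_integrableOn_Ioo (hf : IntegrableOn f (Ioo a b)) {c d : ℝ}
    (hc : c ∈ Icc a b) (hd : d ∈ Icc a b) : IntervalIntegrable f volume c d := by
  have hab : a ≤ b := hc.1.trans hc.2
  refine ((intervalIntegrable_iff_integrableOn_Ioo_of_le hab).2 hf).mono_set ?_
  rw [uIcc_of_le hab]
  exact uIcc_subset_Icc hc hd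

theorem integral_primitive_mul (hf : IntervalIntegrable f volume a b)
    (hg : IntervalIntegrable g volume a b) :
    ∫ x in a..b, (∫ t in a..x, f t) * g x =
      (∫ x in a..b, f x) * (∫ x in a..b, g x) - ∫ x in a..b, f x * ∫ t in a..x, g t := by
  have hderiv : ∀ {h : ℝ → ℝ}, IntervalIntegrable h volume a b →
      ∀ᵐ x, x ∈ uIoc a b → deriv (fun x => ∫ t in a..x, h t) x = h x := fun hh => by
    filter_upwards [hh.ae_hasDerivAt_integral] with x hx hxab
    exact (hx (uIoc_subset_uIcc hxab) a left_mem_uIcc).deriv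
  have hparts := (hf.absolutelyContinuousOnInterval_intervalIntegral
    left_mem_uIcc).integral_mul_deriv_eq_deriv_mul
      (hg.absolutelyContinuousOnInterval_intervalIntegral left_mem_uIcc)
  rw [intervalIntegral.integral_same, zero_mul, sub_zero] at hparts
  refine Eq.trans (intervalIntegral.integral_congr_ae ?_)
    (hparts.trans (congrArg _ (intervalIntegral.integral_congr_ae ?_)))
  · filter_upwards [hderiv hg] with x hx hxab
    rw [hx hxab]
  · filter_upwards [hderiv hf] with x hx hxab
    rw [hx hxab]

theorem integral_deriv_testFunction (η : 𝓓(ioo a b, ℝ)) (x : ℝ) :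
    ∫ t in a..x, deriv η t = η x := by
  have hη : ContDiff ℝ ∞ η := η.contDiff
  rw [intervalIntegral.integral_deriv_eq_sub (fun t _ => hη.differentiable (by simp) t)
    ((hη.continuous_deriv (by simp)).intervalIntegrable _ _),
    testFunction_apply_eq_zero η left_notMem_Ioo, sub_zero]

end Primitives

section SobolevSpace

variable {ψ φ ψ' φ' : ℝ → ℝ} {c d : ℝ}

theorem isWeakDeriv_primitive (hφ : IntegrableOn φ (Ioo (-1) 1)) :
    IsWeakDeriv (fun x => ∫ t in (-1 : ℝ)..x, φ t) φ := fun η h₁ h₂ h₃ => by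
  let θ : 𝓓(ioo (-1) 1, ℝ) := ⟨η, h₁, h₂, h₃⟩
  have hparts := integral_primitive_mul
    (intervalIntegrable_of_integrableOn_Ioo hφ (left_mem_Icc.2 (by norm_num))
      (right_mem_Icc.2 (by norm_num)))
    ((h₁.continuous_deriv (by simp)).intervalIntegrable (-1) 1)
  rw [integral_Ioo_eq _ (by norm_num), integral_Ioo_eq _ (by norm_num), hparts,
    show deriv η = deriv θ from rfl, integral_deriv_testFunction,
    testFunction_apply_eq_zero θ right_notMem_Ioo, mul_zero, zero_sub]
  simp only [integral_deriv_testFunction]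
  rfl

theorem continuousOn_primitive (hφ : IntegrableOn φ (Ioo (-1) 1)) :
    ContinuousOn (fun x => ∫ t in (-1 : ℝ)..x, φ t) (Icc (-1) 1) := by
  rw [← uIcc_of_le (by norm_num : (-1 : ℝ) ≤ 1)]
  exact intervalIntegral.continuousOn_primitive_interval' (intervalIntegrable_of_integrableOn_Ioo hφ
    (left_mem_Icc.2 (by norm_num)) (right_mem_Icc.2 (by norm_num))) left_mem_uIcc

theorem IsH10.integrableOn (h : IsH10 ψ φ) : IntegrableOn φ (Ioo (-1) 1) :=
  h.memLp.integrable one_le_two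

theorem IsH10.eq_integral (h : IsH10 ψ φ) {x : ℝ} (hx : x ∈ Icc (-1 : ℝ) 1) :
    ψ x = ∫ t in (-1 : ℝ)..x, φ t := by
  have hφ := h.integrableOn
  have hint : ∀ {f : ℝ → ℝ}, ContinuousOn f (Icc (-1) 1) → IntegrableOn f (Ioo (-1) 1) :=
    fun hf => hf.integrableOn_Icc.mono_set Ioo_subset_Icc_self
  have hdiff := h.continuousOn.sub (continuousOn_primitive hφ)
  obtain ⟨C, hC⟩ := ae_eq_const_of_integral_mul_deriv_eq_zero (by norm_num) (hint hdiff)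
    fun η => by
      simp only [Pi.sub_apply, sub_mul]
      rw [← coe_lineDerivOp_one,
        integral_sub (integrableOn_mul_testFunction (hint h.continuousOn) _)
          (integrableOn_mul_testFunction (hint (continuousOn_primitive hφ)) _), coe_lineDerivOp_one,
        h.weakDeriv η η.contDiff η.hasCompactSupport η.tsupport_subset,
        isWeakDeriv_primitive hφ η η.contDiff η.hasCompactSupport η.tsupport_subset, sub_self]
  have hconst : EqOn (ψ - fun x => ∫ t in (-1 : ℝ)..x, φ t) (fun _ => C) (Icc (-1) 1) :=
    (Measure.eqOn_open_of_ae_eq hC isOpen_Ioo (hdiff.mono Ioo_subset_Icc_self)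
      continuousOn_const).of_subset_closure hdiff continuousOn_const Ioo_subset_Icc_self
        (closure_Ioo (by norm_num)).ge
  have hC0 : 0 = C := by simpa [h.left] using hconst (left_mem_Icc.2 (by norm_num))
  exact sub_eq_zero.1 ((hconst hx).trans hC0.symm)

theorem isH10_iff : IsH10 ψ φ ↔ MemLp φ 2 (volume.restrict (Ioo (-1) 1)) ∧
    (∀ x ∈ Icc (-1 : ℝ) 1, ψ x = ∫ t in (-1 : ℝ)..x, φ t) ∧ ψ 1 = 0 := by
  refine ⟨fun h => ⟨h.memLp, fun x hx => h.eq_integral hx, h.right⟩, fun ⟨hφ, hψ, h1⟩ => ?_⟩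
  have hφ' : IntegrableOn φ (Ioo (-1) 1) := hφ.integrable one_le_two
  refine ⟨(continuousOn_primitive hφ').congr hψ, hφ, fun η h₁ h₂ h₃ => ?_, ?_, h1⟩
  · rw [← isWeakDeriv_primitive hφ' η h₁ h₂ h₃]
    exact setIntegral_congr_fun measurableSet_Ioo fun x hx => by
      simp only [hψ x (Ioo_subset_Icc_self hx)]
  · rw [hψ _ (left_mem_Icc.2 (by norm_num)), intervalIntegral.integral_same]

theorem IsH10.memLp_self (h : IsH10 ψ φ) : MemLp ψ 2 (volume.restrict (Ioo (-1) 1)) :=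
  memLp_two_of_continuousOn h.continuousOn

theorem IsH10.sub (h : IsH10 ψ φ) (h' : IsH10 ψ' φ') : IsH10 (ψ - ψ') (φ - φ') := by
  refine isH10_iff.2 ⟨h.memLp.sub h'.memLp, fun x hx => ?_, by simp [h.right, h'.right]⟩
  have hx1 : (-1 : ℝ) ∈ Icc (-1 : ℝ) 1 := left_mem_Icc.2 (by norm_num)
  simp only [Pi.sub_apply]
  rw [intervalIntegral.integral_sub (intervalIntegrable_of_integrableOn_Ioo h.integrableOn hx1 hx)
    (intervalIntegrable_of_integrableOn_Ioo h'.integrableOn hx1 hx), h.eq_integral hx,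
    h'.eq_integral hx]

theorem isH10_testFunction (χ : 𝓓(ioo (-1) 1, ℝ)) : IsH10 χ (deriv χ) :=
  isH10_iff.2 ⟨memLp_deriv_testFunction χ, fun x _ => (integral_deriv_testFunction χ x).symm,
    testFunction_apply_eq_zero χ right_notMem_Ioo⟩

theorem IsH10.sub_eq_integral (h : IsH10 ψ φ) (hc : c ∈ Icc (-1 : ℝ) 1)
    (hd : d ∈ Icc (-1 : ℝ) 1) : ψ d - ψ c = ∫ t in c..d, φ t := by
  have hx1 : (-1 : ℝ) ∈ Icc (-1 : ℝ) 1 := left_mem_Icc.2 (by norm_num)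
  rw [h.eq_integral hd, h.eq_integral hc, intervalIntegral.integral_interval_sub_left
    (intervalIntegrable_of_integrableOn_Ioo h.integrableOn hx1 hd)
    (intervalIntegrable_of_integrableOn_Ioo h.integrableOn hx1 hc)]

theorem IsH10.sq_le (h : IsH10 ψ φ) {x : ℝ} (hx : x ∈ Icc (-1 : ℝ) 1) :
    ψ x ^ 2 ≤ (x + 1) * ∫ t in Ioo (-1 : ℝ) 1, φ t ^ 2 := by
  have hsub : Ioo (-1) x ⊆ Ioo (-1) 1 := Ioo_subset_Ioo_right hx.2
  have hφ : MemLp φ 2 (volume.restrict (Ioo (-1) x)) :=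
    h.memLp.mono_measure (Measure.restrict_mono_set _ hsub)
  have hcs := sq_integral_mul_le hφ (memLp_const (1 : ℝ))
  simp only [mul_one, one_pow, integral_const, smul_eq_mul, measureReal_restrict_apply_univ,
    Real.volume_real_Ioo_of_le hx.1, sub_neg_eq_add] at hcs
  rw [h.eq_integral hx, ← integral_Ioo_eq _ hx.1, mul_comm]
  refine hcs.trans (mul_le_mul_of_nonneg_right ?_ (by linarith [hx.1]))
  exact setIntegral_mono_set h.memLp.integrable_sq (ae_of_all _ fun _ => sq_nonneg _)
    hsub.eventuallyLE

theorem IsH10.two_mul_integral_mul (h : IsH10 ψ φ) (hc : c ∈ Icc (-1 : ℝ) 1)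
    (hd : d ∈ Icc (-1 : ℝ) 1) : 2 * ∫ x in c..d, φ x * ψ x = ψ d ^ 2 - ψ c ^ 2 := by
  have hφ := intervalIntegrable_of_integrableOn_Ioo h.integrableOn hc hd
  have hφΦ : IntervalIntegrable (fun x => φ x * ∫ t in c..x, φ t) volume c d :=
    hφ.mul_continuousOn (intervalIntegral.continuousOn_primitive_interval' hφ left_mem_uIcc)
  have hparts := integral_primitive_mul hφ hφ
  simp only [mul_comm _ (φ _)] at hparts
  have hsplit : ∫ x in c..d, φ x * ψ x = (∫ x in c..d, φ x * ∫ t in c..x, φ t) +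
      (∫ x in c..d, φ x) * ψ c := by
    rw [← intervalIntegral.integral_mul_const,
      ← intervalIntegral.integral_add hφΦ (hφ.mul_const _)]
    refine intervalIntegral.integral_congr fun x hx => ?_
    simp only [← h.sub_eq_integral hc (uIcc_subset_Icc hc hd hx)]
    ring
  rw [hsplit]
  rw [← h.sub_eq_integral hc hd] at hparts ⊢
  linarith

theorem IsH10.mul_sq_sub_sq_le (h : IsH10 ψ φ) (hc : c ∈ Icc (-1 : ℝ) 1)
    (hd : d ∈ Icc (-1 : ℝ) 1) (hcd : c ≤ d) (k : ℝ) :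
    k * (ψ d ^ 2 - ψ c ^ 2) ≤ (∫ x in c..d, φ x ^ 2) + k ^ 2 * ∫ x in c..d, ψ x ^ 2 := by
  have hint : ∀ {f : ℝ → ℝ}, IntegrableOn f (Ioo (-1) 1) → IntervalIntegrable f volume c d :=
    fun hf => intervalIntegrable_of_integrableOn_Ioo hf hc hd
  have hφ := hint h.memLp.integrable_sq
  have hψ := (hint h.memLp_self.integrable_sq).const_mul (k ^ 2)
  have hφψ : IntervalIntegrable (fun x => 2 * k * (φ x * ψ x)) volume c d :=
    (hint (h.memLp.integrable_mul h.memLp_self)).const_mul (2 * k)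
  have hnonneg : 0 ≤ ∫ x in c..d, (φ x ^ 2 + k ^ 2 * ψ x ^ 2 - 2 * k * (φ x * ψ x)) :=
    intervalIntegral.integral_nonneg hcd fun x _ => by nlinarith [sq_nonneg (φ x - k * ψ x)]
  rw [intervalIntegral.integral_sub (hφ.add hψ) hφψ, intervalIntegral.integral_add hφ hψ,
    intervalIntegral.integral_const_mul, intervalIntegral.integral_const_mul] at hnonneg
  linarith [congrArg (k * ·) (h.two_mul_integral_mul hc hd)]

theorem IsH10.two_mul_sq_apply_zero_le (h : IsH10 ψ φ) (k : ℝ) :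
    2 * k * ψ 0 ^ 2 ≤ (∫ x in Ioo (-1 : ℝ) 1, φ x ^ 2) +
      k ^ 2 * ∫ x in Ioo (-1 : ℝ) 1, ψ x ^ 2 := by
  have hlower := h.mul_sq_sub_sq_le (c := -1) (d := 0) (by simp) (by simp) (by simp) k
  have hupper := h.mul_sq_sub_sq_le (c := 0) (d := 1) (by simp) (by simp) (by simp) (-k)
  have hsplit : ∀ {f : ℝ → ℝ}, IntegrableOn f (Ioo (-1) 1) →
      ∫ x in Ioo (-1 : ℝ) 1, f x = (∫ x in (-1 : ℝ)..0, f x) + ∫ x in (0 : ℝ)..1, f x := by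
    intro f hf
    rw [integral_Ioo_eq _ (by norm_num), intervalIntegral.integral_add_adjacent_intervals] <;>
      exact intervalIntegrable_of_integrableOn_Ioo hf (by simp) (by simp)
  rw [hsplit h.memLp.integrable_sq, hsplit h.memLp_self.integrable_sq]
  rw [h.left] at hlower
  rw [h.right] at hupper
  linarith

theorem IsH10.integral_sq_pos (h : IsH10 ψ φ) (hn : Nontriv ψ) :
    0 < ∫ x in Ioo (-1 : ℝ) 1, ψ x ^ 2 := by
  obtain ⟨x, hx, hx0⟩ := hn
  rw [integral_Ioo_eq _ (by norm_num)]
  exact intervalIntegral.integral_pos (by norm_num) (h.continuousOn.pow 2)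
    (fun y _ => sq_nonneg _) ⟨x, Ioo_subset_Icc_self hx, by positivity⟩

theorem IsH10.integral_sq_deriv_pos (h : IsH10 ψ φ) (hn : Nontriv ψ) :
    0 < ∫ x in Ioo (-1 : ℝ) 1, φ x ^ 2 := by
  obtain ⟨x, hx, hx0⟩ := hn
  exact pos_of_mul_pos_right ((by positivity : 0 < ψ x ^ 2).trans_le
    (h.sq_le (Ioo_subset_Icc_self hx))) (by linarith [hx.1])

end SobolevSpace

section CriticalNumbers

variable {g j B k c d : ℝ} {ψ φ : ℝ → ℝ}

theorem bddAbove_criticalB_quotients (g j : ℝ) :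
    BddAbove {q : ℝ | ∃ ψ φ : ℝ → ℝ, IsH10 ψ φ ∧ Nontriv ψ ∧
      q = g * j * ψ 0 ^ 2 / ∫ x in Ioo (-1 : ℝ) 1, φ x ^ 2} := by
  refine ⟨|g * j|, ?_⟩
  rintro _ ⟨ψ, φ, h, hn, rfl⟩
  have hval : ψ 0 ^ 2 ≤ ∫ x in Ioo (-1 : ℝ) 1, φ x ^ 2 := by
    simpa using h.sq_le (x := 0) (by simp)
  rw [div_le_iff₀ (h.integral_sq_deriv_pos hn)]
  exact mul_le_mul (le_abs_self _) hval (sq_nonneg _) (abs_nonneg _)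

theorem IsH10.le_criticalB (h : IsH10 ψ φ) (hn : Nontriv ψ) (g j : ℝ) :
    g * j * ψ 0 ^ 2 ≤ criticalB g j ^ 2 * ∫ x in Ioo (-1 : ℝ) 1, φ x ^ 2 := by
  rw [← div_le_iff₀ (h.integral_sq_deriv_pos hn), criticalB, Real.sq_sqrt']
  exact (le_csSup (bddAbove_criticalB_quotients g j) ⟨ψ, φ, h, hn, rfl⟩).trans (le_max_left _ _)

theorem bddAbove_criticalFreqH_quotients (g j : ℝ) (hB : B ≠ 0) :
    BddAbove {q : ℝ | ∃ ψ φ : ℝ → ℝ, IsH10 ψ φ ∧ Nontriv ψ ∧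
      q = (g * j * ψ 0 ^ 2 - |B| ^ 2 * ∫ x in Ioo (-1 : ℝ) 1, φ x ^ 2) /
        (|B| ^ 2 * ∫ x in Ioo (-1 : ℝ) 1, ψ x ^ 2)} := by
  have hB2 : 0 < |B| ^ 2 := by positivity
  refine ⟨(|g * j| / (2 * |B| ^ 2)) ^ 2, ?_⟩
  rintro _ ⟨ψ, φ, h, hn, rfl⟩
  have htrace := mul_le_mul_of_nonneg_left
    (h.two_mul_sq_apply_zero_le (|g * j| / (2 * |B| ^ 2))) hB2.le
  have habs : |B| ^ 2 * (2 * (|g * j| / (2 * |B| ^ 2)) * ψ 0 ^ 2) = |g * j| * ψ 0 ^ 2 := by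
    field_simp
  have hle := mul_le_mul_of_nonneg_right (le_abs_self (g * j)) (sq_nonneg (ψ 0))
  rw [div_le_iff₀ (mul_pos hB2 (h.integral_sq_pos hn))]
  linarith

theorem IsH10.le_criticalFreqH (h : IsH10 ψ φ) (hn : Nontriv ψ) (hB : B ≠ 0) (g j : ℝ) :
    g * j * ψ 0 ^ 2 ≤ |B| ^ 2 * (∫ x in Ioo (-1 : ℝ) 1, φ x ^ 2) +
      criticalFreqH g j B ^ 2 * (|B| ^ 2 * ∫ x in Ioo (-1 : ℝ) 1, ψ x ^ 2) := by
  have hpos : 0 < |B| ^ 2 * ∫ x in Ioo (-1 : ℝ) 1, ψ x ^ 2 :=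
    mul_pos (by positivity) (h.integral_sq_pos hn)
  rw [← sub_le_iff_le_add', ← div_le_iff₀ hpos, criticalFreqH, Real.sq_sqrt']
  exact (le_csSup (bddAbove_criticalFreqH_quotients g j hB) ⟨ψ, φ, h, hn, rfl⟩).trans
    (le_max_left _ _)

theorem IsH10.integral_sq_le (h : IsH10 ψ φ) :
    ∫ x in Ioo (-1 : ℝ) 1, ψ x ^ 2 ≤ 4 * ∫ x in Ioo (-1 : ℝ) 1, φ x ^ 2 := by
  have hbound : ∀ x ∈ Ioo (-1 : ℝ) 1, ψ x ^ 2 ≤ 2 * ∫ t in Ioo (-1 : ℝ) 1, φ t ^ 2 := fun x hx =>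
    (h.sq_le (Ioo_subset_Icc_self hx)).trans (mul_le_mul_of_nonneg_right (by linarith [hx.2])
      (integral_nonneg fun _ => sq_nonneg _))
  refine (setIntegral_mono_on h.memLp_self.integrable_sq (integrableOn_const (by simp))
    measurableSet_Ioo hbound).trans_eq ?_
  rw [setIntegral_const, Real.volume_real_Ioo_of_le (by norm_num), smul_eq_mul]
  ring

/-- Test functions are dense in `H¹₀`, and `ψ(0)` and both integrals are continuous there. -/
theorem IsH10.exists_testFunction_lt (h : IsH10 ψ φ)
    (hlt : c * (∫ x in Ioo (-1 : ℝ) 1, φ x ^ 2) + d * (∫ x in Ioo (-1 : ℝ) 1, ψ x ^ 2) <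
      k * ψ 0 ^ 2) :
    ∃ χ : 𝓓(ioo (-1) 1, ℝ), c * (∫ x in Ioo (-1 : ℝ) 1, deriv χ x ^ 2) +
      d * (∫ x in Ioo (-1 : ℝ) 1, χ x ^ 2) < k * χ 0 ^ 2 := by
  have hmean : ∫ x in Ioo (-1 : ℝ) 1, φ x = 0 := by
    rw [integral_Ioo_eq _ (by norm_num), ← h.eq_integral (by simp), h.right]
  obtain ⟨χ, hχ⟩ := exists_seq_testFunction_tendsto (by norm_num) h.memLp hmean
  have hsub : ∀ n, IsH10 (ψ - χ n) (φ - deriv (χ n)) := fun n => h.sub (isH10_testFunction (χ n))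
  have hval : Tendsto (fun n => χ n 0) atTop (𝓝 (ψ 0)) := by
    have hsq : Tendsto (fun n => (ψ 0 - χ n 0) ^ 2) atTop (𝓝 0) :=
      squeeze_zero (fun _ => sq_nonneg _)
        (fun n => by simpa using (hsub n).sq_le (x := 0) (by simp)) hχ
    have habs := hsq.sqrt
    simp only [Real.sqrt_sq_eq_abs, Real.sqrt_zero] at habs
    simpa using tendsto_const_nhds (x := ψ 0) |>.sub (tendsto_zero_iff_abs_tendsto_zero _ |>.2 habs)
  have hself : Tendsto (fun n => ∫ x in Ioo (-1 : ℝ) 1, (ψ x - χ n x) ^ 2) atTop (𝓝 0) :=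
    squeeze_zero (fun _ => integral_nonneg fun _ => sq_nonneg _)
      (fun n => (hsub n).integral_sq_le) (by simpa using hχ.const_mul 4)
  have hderivSq := tendsto_integral_sq h.memLp (fun n => memLp_deriv_testFunction (χ n)) hχ
  have hselfSq := tendsto_integral_sq h.memLp_self (fun n => memLp_testFunction (χ n)) hself
  obtain ⟨n, hn⟩ := (((hderivSq.const_mul c).add (hselfSq.const_mul d)).eventually_lt
    ((hval.pow 2).const_mul k) hlt).exists
  exact ⟨χ n, hn⟩

theorem exists_testFunction_of_lt_criticalFreqH (hB : B ≠ 0) (hk : 0 ≤ k)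
    (hlt : k < criticalFreqH g j B) :
    ∃ χ : 𝓓(ioo (-1) 1, ℝ), |B| ^ 2 * (∫ x in Ioo (-1 : ℝ) 1, deriv χ x ^ 2) +
      |B| ^ 2 * k ^ 2 * (∫ x in Ioo (-1 : ℝ) 1, χ x ^ 2) < g * j * χ 0 ^ 2 := by
  rw [criticalFreqH, Real.lt_sqrt hk] at hlt
  obtain ⟨_, ⟨ψ, φ, h, hn, rfl⟩, hq⟩ := exists_lt_of_lt_csSup
    (nonempty_iff_ne_empty.2 fun hempty => by
      rw [hempty, Real.sSup_empty] at hlt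
      exact (sq_nonneg k).not_gt hlt) hlt
  rw [lt_div_iff₀ (mul_pos (by positivity) (h.integral_sq_pos hn))] at hq
  exact h.exists_testFunction_lt (by linarith)

end CriticalNumbers

theorem continuousOn_of_antitoneOn_of_sq_mul {h : ℝ → ℝ} (h_anti : AntitoneOn h (Ioi 0))
    (h_sq : ∀ x y, 0 < x → x ≤ y → h x ≤ (y / x) ^ 2 * h y) : ContinuousOn h (Ioi 0) := by
  intro a ha
  refine ContinuousAt.continuousWithinAt ?_
  have ha : 0 < a := ha
  have hlim : Tendsto (fun x => (a / x) ^ 2 * h a) (𝓝 a) (𝓝 (h a)) := by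
    have : ContinuousAt (fun x => (a / x) ^ 2 * h a) a :=
      ((continuousAt_const.div continuousAt_id ha.ne').pow 2).mul continuousAt_const
    simpa [ContinuousAt, ha.ne'] using this
  have hmin := (tendsto_const_nhds (x := h a) (f := 𝓝 a)).min hlim
  have hmax := (tendsto_const_nhds (x := h a) (f := 𝓝 a)).max hlim
  rw [min_self] at hmin
  rw [max_self] at hmax
  refine tendsto_of_tendsto_of_tendsto_of_le_of_le' hmin hmax ?_ ?_
  · filter_upwards [lt_mem_nhds ha] with x hx
    rcases le_total a x with hax | hxa
    · refine (min_le_right _ _).trans ?_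
      have := mul_le_mul_of_nonneg_left (h_sq a x ha hax) (sq_nonneg (a / x))
      rwa [← mul_assoc, ← mul_pow, div_mul_div_cancel₀ hx.ne', div_self ha.ne', one_pow,
        one_mul] at this
    · exact (min_le_left _ _).trans (h_anti hx ha hxa)
  · filter_upwards [lt_mem_nhds ha] with x hx
    rcases le_total a x with hax | hxa
    · exact (h_anti ha hx hax).trans (le_max_left _ _)
    · exact (h_sq x a hx hxa).trans (le_max_right _ _)

section Representer

variable {V : Type*} [AddCommGroup V] [Module ℝ V] {E E' : LinearMap.BilinForm ℝ V}
  {T : V →ₗ[ℝ] ℝ} {u u' : V}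

theorem sq_apply_le_of_eq_apply (hE : E.IsPosSemidef) (hu : E u = T) (v : V) :
    T v ^ 2 ≤ T u * E v v := by
  simpa only [hu] using
    E.apply_sq_le_of_symm hE.isNonneg.nonneg (LinearMap.BilinForm.isSymm_iff.1 hE.isSymm) u v

theorem apply_le_mul_apply_of_form_le {s : ℝ} (hE : E.IsPosSemidef) (hE' : E'.IsPosSemidef)
    (hu : E u = T) (hu' : E' u' = T) (hs : 0 ≤ s) (h : E' u u ≤ s * E u u) :
    T u ≤ s * T u' := by
  have hTu : 0 ≤ T u := hu ▸ hE.isNonneg.nonneg u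
  have hTu' : 0 ≤ T u' := hu' ▸ hE'.isNonneg.nonneg u'
  rcases hTu.eq_or_lt with h0 | hpos
  · exact h0 ▸ mul_nonneg hs hTu'
  refine le_of_mul_le_mul_right ?_ hpos
  calc T u * T u = T u ^ 2 := (sq _).symm
    _ ≤ T u' * E' u u := sq_apply_le_of_eq_apply hE' hu' u
    _ ≤ T u' * (s * E u u) := mul_le_mul_of_nonneg_left h hTu'
    _ = s * T u' * T u := by rw [hu]; ring

end Representer

section Pencil

variable {V : Type*} [AddCommGroup V] [Module ℝ V]

/-- The quadratic pencil of bilinear forms `l² R + l M + K`; below `R` is the inertial, `M` the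
viscous and `K` the magnetic form of the two fluids, and `l` is the growth rate. -/
def pencil (R M K : LinearMap.BilinForm ℝ V) (l : ℝ) : LinearMap.BilinForm ℝ V :=
  l ^ 2 • R + l • M + K

variable {R M K : LinearMap.BilinForm ℝ V} {T : V →ₗ[ℝ] ℝ} {l : ℝ}

theorem pencil_apply (R M K : LinearMap.BilinForm ℝ V) (l : ℝ) (u v : V) :
    pencil R M K l u v = l ^ 2 * R u v + l * M u v + K u v := rfl

theorem isPosSemidef_pencil (hR : R.IsPosSemidef) (hM : M.IsPosSemidef) (hK : K.IsPosSemidef)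
    (hl : 0 ≤ l) : (pencil R M K l).IsPosSemidef :=
  ((hR.smul (sq_nonneg l)).add (hM.smul hl)).add hK

theorem pencil_apply_self_mono (hR : R.IsPosSemidef) (hM : M.IsPosSemidef) {x y : ℝ} (hx : 0 ≤ x)
    (hxy : x ≤ y) (v : V) : pencil R M K x v v ≤ pencil R M K y v v := by
  simp only [pencil_apply]
  have := hR.isNonneg.nonneg v
  have := hM.isNonneg.nonneg v
  gcongr

theorem pencil_apply_self_le_div_sq_mul (hM : M.IsPosSemidef) (hK : K.IsPosSemidef) {x y : ℝ}
    (hx : 0 < x) (hxy : x ≤ y) (v : V) :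
    pencil R M K y v v ≤ (y / x) ^ 2 * pencil R M K x v v := by
  have hMv := mul_nonneg (hx.le.trans hxy) (hM.isNonneg.nonneg v)
  have h1 : 1 ≤ y / x := (one_le_div hx).2 hxy
  calc pencil R M K y v v = y ^ 2 * R v v + y * M v v + K v v := pencil_apply ..
    _ ≤ y ^ 2 * R v v + y / x * (y * M v v) + (y / x) ^ 2 * K v v := by
      have := le_mul_of_one_le_left hMv h1
      have := le_mul_of_one_le_left (hK.isNonneg.nonneg v) (one_le_pow₀ h1 (n := 2))
      linarith
    _ = (y / x) ^ 2 * pencil R M K x v v := by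
      rw [pencil_apply]; field_simp

variable {u : ℝ → V}

theorem continuousOn_apply_representer (hR : R.IsPosSemidef) (hM : M.IsPosSemidef)
    (hK : K.IsPosSemidef) (hu : ∀ l, 0 < l → pencil R M K l (u l) = T) :
    ContinuousOn (fun l => T (u l)) (Ioi 0) := by
  have hE (l : ℝ) (hl : 0 < l) := isPosSemidef_pencil hR hM hK hl.le
  refine continuousOn_of_antitoneOn_of_sq_mul (fun x hx y hy hxy => ?_) fun x y hx hxy => ?_
  · simpa using apply_le_mul_apply_of_form_le (hE y hy) (hE x hx) (hu y hy) (hu x hx) zero_le_one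
      (by simpa using pencil_apply_self_mono hR hM (le_of_lt hx) hxy (u y))
  · have hy := hx.trans_le hxy
    exact apply_le_mul_apply_of_form_le (hE x hx) (hE y hy) (hu x hx) (hu y hy) (sq_nonneg _)
      (pencil_apply_self_le_div_sq_mul hM hK hx hxy (u x))

theorem exists_one_le_mul_apply_representer (hR : R.IsPosSemidef) (hM : M.IsPosSemidef)
    (hK : K.IsPosSemidef) (hu : ∀ l, 0 < l → pencil R M K l (u l) = T) {G : ℝ} {v : V}
    (hv : K v v < G * T v ^ 2) : ∃ l, 0 < l ∧ 1 ≤ G * T (u l) := by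
  have hlim : Tendsto (fun l => pencil R M K l v v) (𝓝[>] 0) (𝓝 (K v v)) := by
    have : Continuous fun l => pencil R M K l v v := by
      simp only [pencil_apply]; fun_prop
    simpa [pencil_apply] using (this.tendsto 0).mono_left nhdsWithin_le_nhds
  obtain ⟨l, hlt, hl⟩ := ((hlim.eventually_lt_const hv).and self_mem_nhdsWithin).exists
  refine ⟨l, hl, ?_⟩
  have hE := isPosSemidef_pencil hR hM hK (le_of_lt hl)
  have hTu : 0 ≤ T (u l) := hu l hl ▸ hE.isNonneg.nonneg (u l)
  have hTv : 0 < T v ^ 2 := (sq_nonneg _).lt_of_ne' fun h0 => by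
    rw [h0, mul_zero] at hv
    exact hv.not_ge (hK.isNonneg.nonneg v)
  refine le_of_mul_le_mul_right ?_ hTv
  calc 1 * T v ^ 2 = T v ^ 2 := one_mul _
    _ ≤ T (u l) * pencil R M K l v v := sq_apply_le_of_eq_apply hE (hu l hl) v
    _ ≤ T (u l) * (G * T v ^ 2) := mul_le_mul_of_nonneg_left hlt.le hTu
    _ = G * T (u l) * T v ^ 2 := by ring

theorem sq_mul_apply_representer_le_one (hR : R.IsPosSemidef) (hM : M.IsPosSemidef)
    (hK : K.IsPosSemidef) {κ : ℝ} (hκ : ∀ v, κ * T v ^ 2 ≤ R v v) {v : V} (hl : 0 ≤ l)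
    (hv : pencil R M K l v = T) :
    l ^ 2 * κ * T v ≤ 1 := by
  have hTv : 0 ≤ T v := hv ▸ (isPosSemidef_pencil hR hM hK hl).isNonneg.nonneg v
  rcases hTv.eq_or_lt with h0 | hpos
  · rw [← h0, mul_zero]
    exact zero_le_one
  refine le_of_mul_le_mul_right ?_ hpos
  calc l ^ 2 * κ * T v * T v = l ^ 2 * (κ * T v ^ 2) := by ring
    _ ≤ l ^ 2 * R v v := mul_le_mul_of_nonneg_left (hκ v) (sq_nonneg l)
    _ ≤ pencil R M K l v v := by
      have := mul_nonneg hl (hM.isNonneg.nonneg v)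
      have := hK.isNonneg.nonneg v
      rw [pencil_apply]; linarith
    _ = 1 * T v := by rw [hv, one_mul]

theorem exists_mul_apply_representer_eq_one (hR : R.IsPosSemidef) (hM : M.IsPosSemidef)
    (hK : K.IsPosSemidef) (hu : ∀ l, 0 < l → pencil R M K l (u l) = T) {κ G : ℝ} (hκ : 0 < κ)
    (hRT : ∀ v, κ * T v ^ 2 ≤ R v v) (hKT : ∃ v, K v v < G * T v ^ 2) :
    ∃ l, 0 < l ∧ G * T (u l) = 1 := by
  obtain ⟨v, hv⟩ := hKT
  have hG : 0 < G := pos_of_mul_pos_left ((hK.isNonneg.nonneg v).trans_lt hv) (sq_nonneg _)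
  obtain ⟨x, hx, hGx⟩ := exists_one_le_mul_apply_representer hR hM hK hu hv
  have hy : 0 < √(G / κ) := Real.sqrt_pos.2 (div_pos hG hκ)
  have hGy : G * T (u √(G / κ)) ≤ 1 := by
    have := sq_mul_apply_representer_le_one hR hM hK hRT hy.le (hu _ hy)
    rwa [Real.sq_sqrt (div_pos hG hκ).le, div_mul_cancel₀ _ hκ.ne'] at this
  obtain ⟨l, hl, hGl⟩ := isPreconnected_Ioi.intermediate_value (mem_Ioi.2 hy) (mem_Ioi.2 hx)
    ((continuousOn_apply_representer hR hM hK hu).const_mul G) ⟨hGy, hGx⟩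
  exact ⟨l, hl, hGl⟩

end Pencil

/-- The space of smooth functions on the line, on which differentiation is an endomorphism. -/
def smooth : Submodule ℝ (ℝ → ℝ) where
  carrier := {F | ContDiff ℝ ∞ F}
  add_mem' := fun {_ _} (hF : ContDiff ℝ ∞ _) hG => hF.add hG
  zero_mem' := (contDiff_const : ContDiff ℝ ∞ fun _ : ℝ => (0 : ℝ))
  smul_mem' := fun c _ (hF : ContDiff ℝ ∞ _) => hF.const_smul c

instance : CoeFun smooth fun _ => ℝ → ℝ := ⟨Subtype.val⟩

theorem contDiff_smooth (F : smooth) : ContDiff ℝ ∞ F := F.2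

theorem differentiableAt_smooth (F : smooth) (x : ℝ) : DifferentiableAt ℝ F x :=
  (contDiff_smooth F).differentiable (by simp) x

@[fun_prop]
theorem continuous_smooth (F : smooth) : Continuous F := (contDiff_smooth F).continuous

/-- Differentiation of smooth functions. -/
def D : Module.End ℝ smooth where
  toFun F := ⟨deriv F, (contDiff_infty_iff_deriv.1 (contDiff_smooth F)).2⟩
  map_add' F G := Subtype.ext <| funext fun x =>
    deriv_add (differentiableAt_smooth F x) (differentiableAt_smooth G x)
  map_smul' c F := Subtype.ext <| funext fun x => deriv_const_smul c (differentiableAt_smooth F x)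

theorem coe_D (F : smooth) : (D F : ℝ → ℝ) = deriv F := rfl

theorem coe_D_pow (n : ℕ) (F : smooth) : ((D ^ n) F : ℝ → ℝ) = iteratedDeriv n F := by
  induction n with
  | zero => simp
  | succ n ih => rw [pow_succ', Module.End.mul_apply, coe_D, ih, iteratedDeriv_succ]

theorem hasDerivAt_smooth (F : smooth) (x : ℝ) : HasDerivAt F (D F x) x :=
  (differentiableAt_smooth F x).hasDerivAt

/-- The bilinear form `∫ F G` of `L²((a,b))` on smooth functions. -/
def l2Form (a b : ℝ) : LinearMap.BilinForm ℝ smooth :=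
  LinearMap.mk₂ ℝ (fun F G => ∫ x in a..b, F x * G x)
    (fun F₁ F₂ G => by
      rw [← intervalIntegral.integral_add
        (Continuous.intervalIntegrable (by fun_prop) _ _)
        (Continuous.intervalIntegrable (by fun_prop) _ _)]
      simp [add_mul])
    (fun c F G => by
      simp [mul_assoc])
    (fun F G₁ G₂ => by
      rw [← intervalIntegral.integral_add
        (Continuous.intervalIntegrable (by fun_prop) _ _)
        (Continuous.intervalIntegrable (by fun_prop) _ _)]
      simp [mul_add])
    (fun c F G => by
      simp [mul_left_comm])

theorem l2Form_apply (a b : ℝ) (F G : smooth) : l2Form a b F G = ∫ x in a..b, F x * G x := rfl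

theorem l2Form_self (a b : ℝ) (F : smooth) : l2Form a b F F = ∫ x in a..b, F x ^ 2 := by
  simp only [l2Form_apply, sq]

theorem isPosSemidef_l2Form {a b : ℝ} (hab : a ≤ b) : (l2Form a b).IsPosSemidef where
  eq F G := by simp only [l2Form_apply, mul_comm]
  nonneg F := intervalIntegral.integral_nonneg hab fun x _ => mul_self_nonneg (F x)

theorem eqOn_zero_of_l2Form_self {a b : ℝ} (hab : a < b) {F : smooth} (h : l2Form a b F F = 0) :
    EqOn F 0 (Icc a b) := by
  intro x hx
  by_contra hne
  have hF : Continuous fun x => F x ^ 2 := by fun_prop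
  refine (intervalIntegral.integral_pos hab hF.continuousOn (fun y _ => sq_nonneg (F y))
    ⟨x, hx, sq_pos_of_ne_zero hne⟩).ne' ?_
  rw [← l2Form_self, h]

theorem l2Form_D_left (a b : ℝ) (F G : smooth) :
    l2Form a b (D F) G = F b * G b - F a * G a - l2Form a b F (D G) := by
  rw [l2Form_apply, l2Form_apply, intervalIntegral.integral_mul_deriv_eq_deriv_mul
    (fun x _ => hasDerivAt_smooth F x) (fun x _ => hasDerivAt_smooth G x)
    (Continuous.intervalIntegrable (by fun_prop) _ _)
    (Continuous.intervalIntegrable (by fun_prop) _ _)]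
  ring

theorem isPosSemidef_comp {V W : Type*} [AddCommMonoid V] [Module ℝ V] [AddCommMonoid W]
    [Module ℝ W] {B : LinearMap.BilinForm ℝ W} (hB : B.IsPosSemidef) (f : V →ₗ[ℝ] W) :
    (B.comp f f).IsPosSemidef where
  eq x y := hB.isSymm.eq (f x) (f y)
  nonneg x := hB.isNonneg.nonneg (f x)

section Layer

variable (k a b : ℝ)

/-- The form `∫ k² F G + F' G'`, the energy of the velocity field with stream function
`F(x₂) sin(k x₁)` in the layer `a < x₂ < b`. -/
def dirichletLayer : LinearMap.BilinForm ℝ smooth :=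
  k ^ 2 • l2Form a b + (l2Form a b).comp D D

/-- The form `∫ 4 k² F' G' + (F'' + k² F)(G'' + k² G)`, the viscous dissipation of the velocity
field with stream function `F(x₂) sin(k x₁)` in the layer `a < x₂ < b`. -/
def viscousLayer : LinearMap.BilinForm ℝ smooth :=
  (4 * k ^ 2) • (l2Form a b).comp D D + (l2Form a b).comp (D ^ 2 + k ^ 2 • 1) (D ^ 2 + k ^ 2 • 1)

variable {a b}

theorem isPosSemidef_dirichletLayer (hab : a ≤ b) : (dirichletLayer k a b).IsPosSemidef :=
  ((isPosSemidef_l2Form hab).smul (sq_nonneg k)).add (isPosSemidef_comp (isPosSemidef_l2Form hab) D)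

theorem isPosSemidef_viscousLayer (hab : a ≤ b) : (viscousLayer k a b).IsPosSemidef :=
  ((isPosSemidef_comp (isPosSemidef_l2Form hab) D).smul (by positivity)).add
    (isPosSemidef_comp (isPosSemidef_l2Form hab) _)

/-- The fourth-order equation of one fluid, where `α = l² ρ + B² k²` and `ν = l μ`. -/
def IsLayerSolution (α ν : ℝ) (F : smooth) : Prop :=
  ν • ((D ^ 4) F - (2 * k ^ 2) • (D ^ 2) F + k ^ 4 • F) + α • (k ^ 2 • F - (D ^ 2) F) = 0

/-- The boundary expression in Green's identity for the fourth-order equation of one fluid. -/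
def layerFlux (α ν : ℝ) (F G : smooth) (x : ℝ) : ℝ :=
  α * D F x * G x + ν * (((D ^ 2) F x + k ^ 2 * F x) * D G x -
    ((D ^ 3) F x - 3 * k ^ 2 * D F x) * G x)

variable {k}

theorem IsLayerSolution.green {α ν : ℝ} {F : smooth} (h : IsLayerSolution k α ν F) (a b : ℝ)
    (G : smooth) :
    α * dirichletLayer k a b F G + ν * viscousLayer k a b F G =
      layerFlux k α ν F G b - layerFlux k α ν F G a := by
  have hode := congrArg (fun H => l2Form a b H G) h
  have h1 := l2Form_D_left a b F (D G)
  have h2 := l2Form_D_left a b (D F) G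
  have h3 := l2Form_D_left a b ((D ^ 2) F) (D G)
  have h4 := l2Form_D_left a b ((D ^ 3) F) G
  simp only [pow_succ', pow_zero, mul_one, Module.End.mul_apply, map_add, map_sub, map_smul,
    map_zero, LinearMap.add_apply, LinearMap.sub_apply, LinearMap.smul_apply, LinearMap.zero_apply,
    smul_eq_mul, dirichletLayer, viscousLayer, layerFlux, LinearMap.BilinForm.comp_apply,
    Module.End.one_apply] at *
  linear_combination hode + k ^ 2 * ν * h1 + (α + 3 * k ^ 2 * ν) * h2 + ν * (h3 - h4)

end Layer

/-- The Dirichlet energy of a pair of functions on the lower and the upper fluid, with the weight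
`ρm` in the lower and `ρp` in the upper one. -/
def dirichletForm (k ρm ρp : ℝ) : LinearMap.BilinForm ℝ (smooth × smooth) :=
  ρm • (dirichletLayer k (-1) 0).comp (LinearMap.fst ℝ _ _) (LinearMap.fst ℝ _ _) +
    ρp • (dirichletLayer k 0 1).comp (LinearMap.snd ℝ _ _) (LinearMap.snd ℝ _ _)

/-- The viscous dissipation of a pair of functions on the lower and the upper fluid, with the
viscosity `μm` in the lower and `μp` in the upper one. -/
def viscousForm (k μm μp : ℝ) : LinearMap.BilinForm ℝ (smooth × smooth) :=
  μm • (viscousLayer k (-1) 0).comp (LinearMap.fst ℝ _ _) (LinearMap.fst ℝ _ _) +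
    μp • (viscousLayer k 0 1).comp (LinearMap.snd ℝ _ _) (LinearMap.snd ℝ _ _)

theorem isPosSemidef_dirichletForm (k : ℝ) {ρm ρp : ℝ} (hρm : 0 ≤ ρm) (hρp : 0 ≤ ρp) :
    (dirichletForm k ρm ρp).IsPosSemidef :=
  ((isPosSemidef_comp (isPosSemidef_dirichletLayer k (by norm_num)) _).smul hρm).add
    ((isPosSemidef_comp (isPosSemidef_dirichletLayer k (by norm_num)) _).smul hρp)

theorem isPosSemidef_viscousForm (k : ℝ) {μm μp : ℝ} (hμm : 0 ≤ μm) (hμp : 0 ≤ μp) :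
    (viscousForm k μm μp).IsPosSemidef :=
  ((isPosSemidef_comp (isPosSemidef_viscousLayer k (by norm_num)) _).smul hμm).add
    ((isPosSemidef_comp (isPosSemidef_viscousLayer k (by norm_num)) _).smul hμp)

theorem dirichletForm_apply (k ρm ρp : ℝ) (u v : smooth × smooth) :
    dirichletForm k ρm ρp u v =
      ρm * dirichletLayer k (-1) 0 u.1 v.1 + ρp * dirichletLayer k 0 1 u.2 v.2 := rfl

theorem viscousForm_apply (k μm μp : ℝ) (u v : smooth × smooth) :
    viscousForm k μm μp u v =
      μm * viscousLayer k (-1) 0 u.1 v.1 + μp * viscousLayer k 0 1 u.2 v.2 := rfl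

theorem mul_dirichletForm_one_le {k c ρm ρp : ℝ} (hm : c ≤ ρm) (hp : c ≤ ρp)
    (u : smooth × smooth) : c * dirichletForm k 1 1 u u ≤ dirichletForm k ρm ρp u u := by
  have := (isPosSemidef_dirichletLayer k (show (-1 : ℝ) ≤ 0 by norm_num)).isNonneg.nonneg u.1
  have := (isPosSemidef_dirichletLayer k (show (0 : ℝ) ≤ 1 by norm_num)).isNonneg.nonneg u.2
  simp only [dirichletForm_apply, one_mul, mul_add]
  gcongr

theorem eqOn_zero_of_dirichletLayer_self {k a b : ℝ} (hk : k ≠ 0) (hab : a < b) {F : smooth}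
    (h : dirichletLayer k a b F F = 0) : EqOn F 0 (Icc a b) := by
  refine eqOn_zero_of_l2Form_self hab ?_
  have hF := (isPosSemidef_l2Form hab.le).isNonneg.nonneg F
  have hDF := (isPosSemidef_l2Form hab.le).isNonneg.nonneg (D F)
  have hsum : k ^ 2 * l2Form a b F F + l2Form a b (D F) (D F) = 0 := h
  have hkF := ((add_eq_zero_iff_of_nonneg (by positivity) hDF).1 hsum).1
  exact (mul_eq_zero.1 hkF).resolve_left (pow_ne_zero 2 hk)

/-- The pairs of functions on the lower and the upper fluid which match to first order on the
interface and vanish to first order on the rigid walls. -/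
def profiles : Submodule ℝ (smooth × smooth) where
  carrier := {u | u.1 (-1) = 0 ∧ D u.1 (-1) = 0 ∧ u.2 1 = 0 ∧ D u.2 1 = 0 ∧
    u.1 0 = u.2 0 ∧ D u.1 0 = D u.2 0}
  add_mem' := by
    rintro u v ⟨h1, h2, h3, h4, h5, h6⟩ ⟨h1', h2', h3', h4', h5', h6'⟩
    simp_all
  zero_mem' := by simp
  smul_mem' := by
    rintro c u ⟨h1, h2, h3, h4, h5, h6⟩
    simp_all

/-- The value of a pair on the interface. -/
def interfaceValue : smooth × smooth →ₗ[ℝ] ℝ :=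
  (LinearMap.proj 0 ∘ₗ smooth.subtype) ∘ₗ LinearMap.snd ℝ _ _

/-- The pair `u` is the response of the two fluids to a normal force `c` on the interface, where
`α = l² ρ + B² k²` and `ν = l μ` in each fluid. -/
structure IsResponse (αm αp νm νp k c : ℝ) (u : smooth × smooth) : Prop where
  mem_profiles : u ∈ profiles
  lower : IsLayerSolution k αm νm u.1
  upper : IsLayerSolution k αp νp u.2
  jump_two : νp * (k ^ 2 * u.2 0 + (D ^ 2) u.2 0) = νm * (k ^ 2 * u.1 0 + (D ^ 2) u.1 0)
  jump_three : νp * ((D ^ 3) u.2 0 - 3 * k ^ 2 * D u.2 0) -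
    νm * ((D ^ 3) u.1 0 - 3 * k ^ 2 * D u.1 0) = (αp - αm) * D u.2 0 + c

theorem IsResponse.energy_eq {αm αp νm νp k c : ℝ} {u v : smooth × smooth}
    (h : IsResponse αm αp νm νp k c u) (hv : v ∈ profiles) :
    dirichletForm k αm αp u v + viscousForm k νm νp u v = c * v.2 0 := by
  obtain ⟨-, -, -, -, -, hDu⟩ := h.mem_profiles
  obtain ⟨hv1, hDv1, hv2, hDv2, hv0, hDv0⟩ := hv
  have hlower := h.lower.green (-1) 0 v.1
  have hupper := h.upper.green 0 1 v.2
  have hjump := h.jump_three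
  simp only [layerFlux, hv1, hDv1, hv2, hDv2, hv0, hDv0, hDu] at hlower hupper hjump
  rw [dirichletForm_apply, viscousForm_apply]
  linear_combination hlower + hupper + v.2 0 * hjump - D v.2 0 * h.jump_two

section Companion

/-- The companion operator of the equation `F'''' = a F + b F''`. -/
def companion (a b : ℝ) : (Fin 4 → ℝ) →L[ℝ] (Fin 4 → ℝ) :=
  (Matrix.mulVecLin !![0, 1, 0, 0; 0, 0, 1, 0; 0, 0, 0, 1; a, 0, b, 0]).toContinuousLinearMap

theorem companion_apply (a b : ℝ) (v : Fin 4 → ℝ) :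
    companion a b v = ![v 1, v 2, v 3, a * v 0 + b * v 2] := by
  ext i
  fin_cases i <;> simp [companion, Matrix.mulVec, dotProduct, Fin.sum_univ_four]

/-- The solution map of the companion system, `x` being the time. -/
def companionFlow (a b x : ℝ) : (Fin 4 → ℝ) →L[ℝ] (Fin 4 → ℝ) :=
  NormedSpace.exp (x • companion a b)

theorem contDiff_companionFlow (a b : ℝ) : ContDiff ℝ ∞ (companionFlow a b) :=
  contDiff_iff_contDiffAt.2 fun x =>
    (NormedSpace.exp_analytic (𝕂 := ℝ) (x • companion a b)).contDiffAt.comp x (by fun_prop)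

theorem hasDerivAt_companionFlow (a b : ℝ) (v : Fin 4 → ℝ) (x : ℝ) :
    HasDerivAt (fun x => companionFlow a b x v) (companion a b (companionFlow a b x v)) x :=
  ((hasDerivAt_exp_smul_const' (companion a b) x).clm_apply (hasDerivAt_const x v)).congr_deriv
    (by simp [companionFlow])

theorem companionFlow_bijective (a b x : ℝ) : Function.Bijective (companionFlow a b x) :=
  letI : NormedAlgebra ℚ ((Fin 4 → ℝ) →L[ℝ] (Fin 4 → ℝ)) := .restrictScalars ℚ ℝ _
  ContinuousLinearMap.isUnit_iff_bijective.1 (NormedSpace.isUnit_exp _)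

/-- The components of the companion flow, as functions of time. The `0`-th one is the general
solution of `F'''' = a F + b F''`. -/
def companionComponent (a b : ℝ) (i : Fin 4) : (Fin 4 → ℝ) →ₗ[ℝ] smooth where
  toFun v := ⟨fun x => companionFlow a b x v i,
    contDiff_pi.1 ((contDiff_companionFlow a b).clm_apply contDiff_const) i⟩
  map_add' v w := by ext x; simp
  map_smul' c v := by ext x; simp

theorem D_companionComponent (a b : ℝ) (i : Fin 4) (v : Fin 4 → ℝ) :
    D (companionComponent a b i v) = ![companionComponent a b 1 v, companionComponent a b 2 v,
      companionComponent a b 3 v, a • companionComponent a b 0 v + b • companionComponent a b 2 v]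
      i := by
  ext x
  refine (hasDerivAt_pi.1 (hasDerivAt_companionFlow a b v x) i).deriv.trans ?_
  rw [companion_apply]
  fin_cases i <;> rfl

theorem D_pow_companionComponent (a b : ℝ) (i : Fin 4) (v : Fin 4 → ℝ) :
    (D ^ (i : ℕ)) (companionComponent a b 0 v) = companionComponent a b i v := by
  fin_cases i <;> simp [pow_succ', D_companionComponent]

theorem D_pow_four_companionComponent (a b : ℝ) (v : Fin 4 → ℝ) :
    (D ^ 4) (companionComponent a b 0 v) =
      a • companionComponent a b 0 v + b • companionComponent a b 2 v := by
  simp [pow_succ', D_companionComponent]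

theorem companionFlow_apply_eq (a b : ℝ) (v : Fin 4 → ℝ) (x : ℝ) :
    companionFlow a b x v = fun i : Fin 4 => iteratedDeriv i (companionComponent a b 0 v) x := by
  ext i
  rw [← coe_D_pow, D_pow_companionComponent]
  rfl

theorem eq_zero_of_companionComponent_eqOn_zero {a b c d : ℝ} (hcd : c < d) {v : Fin 4 → ℝ}
    (hv : EqOn (companionComponent a b 0 v) 0 (Ioo c d)) : v = 0 := by
  obtain ⟨x, hx⟩ := nonempty_Ioo.2 hcd
  refine (companionFlow_bijective a b x).injective ?_
  rw [companionFlow_apply_eq, map_zero]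
  ext i
  simpa using hv.iteratedDeriv_of_isOpen isOpen_Ioo i hx

theorem exists_eq_companionFlow {a b c d : ℝ} (hcd : c < d) {y : ℝ → Fin 4 → ℝ}
    (hy : ∀ x ∈ Ioo c d, HasDerivAt y (companion a b (y x)) x) :
    ∃ v, ∀ x ∈ Ioo c d, y x = companionFlow a b x v := by
  obtain ⟨x₀, hx₀⟩ := nonempty_Ioo.2 hcd
  obtain ⟨v, hv⟩ := (companionFlow_bijective a b x₀).surjective (y x₀)
  exact ⟨v, ODE_solution_unique_of_mem_Ioo (s := fun _ => univ)
    (fun _ _ => (companion a b).lipschitz.lipschitzOnWith) hx₀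
    (fun x hx => ⟨hy x hx, mem_univ _⟩)
    (fun x _ => ⟨hasDerivAt_companionFlow a b v x, mem_univ _⟩) hv.symm⟩

theorem hasDerivAt_iteratedDeriv_of_contDiffOn {f : ℝ → ℝ} {s : Set ℝ} (hs : IsOpen s) {n m : ℕ}
    (hf : ContDiffOn ℝ n f s) (hm : m < n) {x : ℝ} (hx : x ∈ s) :
    HasDerivAt (iteratedDeriv m f) (iteratedDeriv (m + 1) f x) x := by
  rw [iteratedDeriv_succ]
  have hd := (hf.differentiableOn_iteratedDerivWithin (m := m) (by exact_mod_cast hm)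
    hs.uniqueDiffOn).congr fun y hy => (iteratedDerivWithin_of_isOpen hs hy).symm
  exact ((hd x hx).differentiableAt (hs.mem_nhds hx)).hasDerivAt

theorem exists_eqOn_companionComponent {a b c d : ℝ} (hcd : c < d) {f : ℝ → ℝ}
    (hf : ContDiffOn ℝ 4 f (Ioo c d))
    (hode : ∀ x ∈ Ioo c d, iteratedDeriv 4 f x = a * f x + b * iteratedDeriv 2 f x) :
    ∃ v, EqOn f (companionComponent a b 0 v) (Ioo c d) := by
  obtain ⟨v, hv⟩ := exists_eq_companionFlow (a := a) (b := b) hcd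
    (y := fun x (i : Fin 4) => iteratedDeriv i f x) fun x hx => hasDerivAt_pi.2 fun i => by
      refine (hasDerivAt_iteratedDeriv_of_contDiffOn isOpen_Ioo (n := 4) (by exact_mod_cast hf)
        i.isLt hx).congr_deriv ?_
      rw [companion_apply]
      fin_cases i <;> simp [hode x hx]
  exact ⟨v, fun x hx => congrFun (hv x hx) 0⟩

end Companion

section LayerSolution

variable {k α ν : ℝ}

theorem isLayerSolution_iff (hν : ν ≠ 0) {F : smooth} : IsLayerSolution k α ν F ↔
    (D ^ 4) F = (-(k ^ 4 + α * k ^ 2 / ν)) • F + (2 * k ^ 2 + α / ν) • (D ^ 2) F := by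
  have hsmul : ν • ((D ^ 4) F - (2 * k ^ 2) • (D ^ 2) F + k ^ 4 • F) +
      α • (k ^ 2 • F - (D ^ 2) F) = ν • ((D ^ 4) F -
        ((-(k ^ 4 + α * k ^ 2 / ν)) • F + (2 * k ^ 2 + α / ν) • (D ^ 2) F)) := by
    match_scalars <;> field
  rw [IsLayerSolution, hsmul, smul_eq_zero_iff_right hν, sub_eq_zero]

/-- The general solution of the fourth-order equation of one fluid. -/
def layerSolution (k α ν : ℝ) : (Fin 4 → ℝ) →ₗ[ℝ] smooth :=
  companionComponent (-(k ^ 4 + α * k ^ 2 / ν)) (2 * k ^ 2 + α / ν) 0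

theorem isLayerSolution_layerSolution (hν : ν ≠ 0) (v : Fin 4 → ℝ) :
    IsLayerSolution k α ν (layerSolution k α ν v) := by
  rw [isLayerSolution_iff hν, layerSolution, D_pow_four_companionComponent]
  congr 2
  exact (D_pow_companionComponent _ _ 2 v).symm

theorem exists_isLayerSolution_eqOn (hν : ν ≠ 0) {a b : ℝ} (hab : a < b) {f : ℝ → ℝ}
    (hf : ContDiffOn ℝ 4 f (Ioo a b))
    (hode : ∀ x ∈ Ioo a b,
      ν * (iteratedDeriv 4 f x - 2 * k ^ 2 * iteratedDeriv 2 f x + k ^ 4 * f x) +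
        α * (k ^ 2 * f x - iteratedDeriv 2 f x) = 0) :
    ∃ F, IsLayerSolution k α ν F ∧ EqOn f F (Ioo a b) := by
  obtain ⟨v, hv⟩ := exists_eqOn_companionComponent (a := -(k ^ 4 + α * k ^ 2 / ν))
    (b := 2 * k ^ 2 + α / ν) hab hf fun x hx => by
      have := hode x hx
      field_simp
      linear_combination this
  exact ⟨layerSolution k α ν v, isLayerSolution_layerSolution hν v, hv⟩

end LayerSolution

section Response

variable {αm αp νm νp k : ℝ}

/-- The defects of a pair in the eight boundary and interface conditions of a response. -/
def boundaryDefect (αm αp νm νp k : ℝ) : smooth × smooth →ₗ[ℝ] (Fin 8 → ℝ) where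
  toFun u := ![u.1 (-1), D u.1 (-1), u.2 1, D u.2 1, u.1 0 - u.2 0, D u.1 0 - D u.2 0,
    νp * (k ^ 2 * u.2 0 + (D ^ 2) u.2 0) - νm * (k ^ 2 * u.1 0 + (D ^ 2) u.1 0),
    νp * ((D ^ 3) u.2 0 - 3 * k ^ 2 * D u.2 0) - νm * ((D ^ 3) u.1 0 - 3 * k ^ 2 * D u.1 0) -
      (αp - αm) * D u.2 0]
  map_add' u v := by ext i; fin_cases i <;> simp <;> ring
  map_smul' c u := by ext i; fin_cases i <;> simp <;> ring

theorem isResponse_iff {c : ℝ} {u : smooth × smooth} :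
    IsResponse αm αp νm νp k c u ↔ IsLayerSolution k αm νm u.1 ∧ IsLayerSolution k αp νp u.2 ∧
      boundaryDefect αm αp νm νp k u = ![0, 0, 0, 0, 0, 0, 0, c] := by
  simp only [boundaryDefect, LinearMap.coe_mk, AddHom.coe_mk, Matrix.vecCons_inj, sub_eq_zero,
    and_true]
  constructor
  · rintro ⟨⟨h1, h2, h3, h4, h5, h6⟩, hl, hu, hj2, hj3⟩
    exact ⟨hl, hu, h1, h2, h3, h4, h5, h6, hj2, sub_eq_iff_eq_add'.2 hj3⟩
  · rintro ⟨hl, hu, h1, h2, h3, h4, h5, h6, hj2, hj3⟩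
    exact ⟨⟨h1, h2, h3, h4, h5, h6⟩, hl, hu, hj2, sub_eq_iff_eq_add'.1 hj3⟩

theorem IsResponse.eqOn_zero (hαm : 0 < αm) (hαp : 0 < αp) (hνm : 0 ≤ νm) (hνp : 0 ≤ νp)
    (hk : k ≠ 0) {u : smooth × smooth} (h : IsResponse αm αp νm νp k 0 u) :
    EqOn u.1 0 (Icc (-1) 0) ∧ EqOn u.2 0 (Icc 0 1) := by
  have henergy := h.energy_eq h.mem_profiles
  have hviscous := (isPosSemidef_viscousForm k hνm hνp).isNonneg.nonneg u
  have hlower := (isPosSemidef_dirichletLayer k (show (-1 : ℝ) ≤ 0 by norm_num)).isNonneg.nonneg u.1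
  have hupper := (isPosSemidef_dirichletLayer k (show (0 : ℝ) ≤ 1 by norm_num)).isNonneg.nonneg u.2
  rw [dirichletForm_apply, zero_mul] at henergy
  have hαlower := mul_nonneg hαm.le hlower
  have hαupper := mul_nonneg hαp.le hupper
  exact ⟨eqOn_zero_of_dirichletLayer_self hk (by norm_num)
      ((mul_eq_zero.1 (by linarith)).resolve_left hαm.ne'),
    eqOn_zero_of_dirichletLayer_self hk (by norm_num)
      ((mul_eq_zero.1 (by linarith)).resolve_left hαp.ne')⟩

theorem exists_isResponse (hαm : 0 < αm) (hαp : 0 < αp) (hνm : 0 < νm) (hνp : 0 < νp)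
    (hk : k ≠ 0) (c : ℝ) : ∃ u, IsResponse αm αp νm νp k c u := by
  let S := (layerSolution k αm νm).prodMap (layerSolution k αp νp)
  have hS (w) {c : ℝ} : IsResponse αm αp νm νp k c (S w) ↔
      boundaryDefect αm αp νm νp k (S w) = ![0, 0, 0, 0, 0, 0, 0, c] := by
    simp [isResponse_iff, S, isLayerSolution_layerSolution, hνm.ne', hνp.ne']
  have hinj : Function.Injective (boundaryDefect αm αp νm νp k ∘ₗ S) := by
    refine (injective_iff_map_eq_zero _).2 fun w hw => ?_
    have hresponse : IsResponse αm αp νm νp k 0 (S w) := (hS w).2 <| hw.trans <| by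
      ext i; fin_cases i <;> rfl
    obtain ⟨hlower, hupper⟩ := hresponse.eqOn_zero hαm hαp hνm.le hνp.le hk
    exact Prod.ext
      (eq_zero_of_companionComponent_eqOn_zero (by norm_num) (hlower.mono Ioo_subset_Icc_self))
      (eq_zero_of_companionComponent_eqOn_zero (by norm_num) (hupper.mono Ioo_subset_Icc_self))
  obtain ⟨w, hw⟩ := (LinearMap.injective_iff_surjective_of_finrank_eq_finrank (by simp)).1 hinj
    ![0, 0, 0, 0, 0, 0, 0, c]
  exact ⟨S w, (hS w).2 hw⟩

end Response

theorem dirichletForm_add_mul (k l b ρm ρp : ℝ) :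
    dirichletForm k (l ^ 2 * ρm + b) (l ^ 2 * ρp + b) =
      l ^ 2 • dirichletForm k ρm ρp + b • dirichletForm k 1 1 := by
  simp only [dirichletForm]
  module

theorem viscousForm_mul (k l μm μp : ℝ) :
    viscousForm k (l * μm) (l * μp) = l • viscousForm k μm μp := by
  simp only [viscousForm]
  module

section Glue

/-- The function on `[-1, 1]` given by the first component of a pair in the lower fluid and by the
second one in the upper fluid. -/
def glue (u : smooth × smooth) (x : ℝ) : ℝ := if x ≤ 0 then u.1 x else u.2 x

variable {u : smooth × smooth}

theorem eqOn_glue_lower (u : smooth × smooth) : EqOn (glue u) u.1 (Iic 0) := fun _ hx => if_pos hx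

theorem eqOn_glue_upper (h : u.1 0 = u.2 0) : EqOn (glue u) u.2 (Ici 0) := by
  rintro x (hx : 0 ≤ x)
  rcases hx.eq_or_lt with rfl | hpos
  · exact (if_pos le_rfl).trans h
  · exact if_neg hpos.not_ge

theorem glue_apply_zero (h : u.1 0 = u.2 0) : glue u 0 = interfaceValue u :=
  eqOn_glue_upper h self_mem_Ici

theorem continuous_glue (h : u.1 0 = u.2 0) : Continuous (glue u) :=
  (continuous_smooth u.1).if_le (continuous_smooth u.2) continuous_id continuous_const
    (by rintro x rfl; exact h)

theorem hasDerivWithinAt_glue (h : u.1 0 = u.2 0) (hD : D u.1 0 = D u.2 0) (x : ℝ) :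
    HasDerivWithinAt (glue u) (glue (D u.1, D u.2) x) (Ioi x) x := by
  rcases lt_or_ge x 0 with hx | hx
  · rw [eqOn_glue_lower _ hx.le]
    exact ((hasDerivAt_smooth u.1 x).congr_of_eventuallyEq
      ((eqOn_glue_lower u).eventuallyEq_of_mem (Iic_mem_nhds hx))).hasDerivWithinAt
  · rw [eqOn_glue_upper hD hx]
    exact (hasDerivAt_smooth u.2 x).hasDerivWithinAt.congr
      (fun y hy => eqOn_glue_upper h (hx.trans (le_of_lt hy))) (eqOn_glue_upper h hx)

theorem isH10_glue (hu : u ∈ profiles) : IsH10 (glue u) (glue (D u.1, D u.2)) := by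
  obtain ⟨hleft, -, hright, -, h0, hD0⟩ := hu
  have hcont : Continuous (glue (D u.1, D u.2)) := continuous_glue hD0
  refine isH10_iff.2 ⟨memLp_two_of_continuousOn hcont.continuousOn, fun x _ => ?_, ?_⟩
  · rw [intervalIntegral.integral_eq_sub_of_hasDeriv_right (continuous_glue h0).continuousOn
      (fun y _ => hasDerivWithinAt_glue h0 hD0 y) (hcont.intervalIntegrable _ _),
      eqOn_glue_lower u (by simp : (-1 : ℝ) ∈ Iic 0), hleft, sub_zero]
  · rw [eqOn_glue_upper h0 (by simp : (1 : ℝ) ∈ Ici 0), hright]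

theorem setIntegral_glue_sq (h : u.1 0 = u.2 0) :
    ∫ x in Ioo (-1 : ℝ) 1, glue u x ^ 2 = l2Form (-1) 0 u.1 u.1 + l2Form 0 1 u.2 u.2 := by
  have hint (a b : ℝ) : IntervalIntegrable (fun x => glue u x ^ 2) volume a b :=
    ((continuous_glue h).pow 2).intervalIntegrable a b
  rw [integral_Ioo_eq _ (by norm_num),
    ← intervalIntegral.integral_add_adjacent_intervals (hint _ 0) (hint 0 _), l2Form_self,
    l2Form_self]
  congr 1 <;> refine intervalIntegral.integral_congr fun x hx => ?_ <;>
    rw [uIcc_of_le (by norm_num)] at hx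
  · exact congrArg (· ^ 2) (eqOn_glue_lower u hx.2)
  · exact congrArg (· ^ 2) (eqOn_glue_upper h hx.1)

theorem dirichletForm_one_self_eq (k : ℝ) (hu : u ∈ profiles) :
    dirichletForm k 1 1 u u = k ^ 2 * (∫ x in Ioo (-1 : ℝ) 1, glue u x ^ 2) +
      ∫ x in Ioo (-1 : ℝ) 1, glue (D u.1, D u.2) x ^ 2 := by
  obtain ⟨-, -, -, -, h0, hD0⟩ := hu
  rw [setIntegral_glue_sq h0, setIntegral_glue_sq (u := (D u.1, D u.2)) hD0, dirichletForm_apply]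
  simp only [dirichletLayer, LinearMap.add_apply, LinearMap.smul_apply, smul_eq_mul,
    LinearMap.BilinForm.comp_apply]
  ring

theorem mul_interfaceValue_sq_le_dirichletForm {c k ρm ρp : ℝ} (hc : 0 ≤ c) (hm : c ≤ ρm)
    (hp : c ≤ ρp) (hu : u ∈ profiles) :
    c * (2 * k) * interfaceValue u ^ 2 ≤ dirichletForm k ρm ρp u u := by
  have hvalue := glue_apply_zero hu.2.2.2.2.1
  calc c * (2 * k) * interfaceValue u ^ 2 = c * (2 * k * glue u 0 ^ 2) := by rw [hvalue, mul_assoc]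
    _ ≤ c * dirichletForm k 1 1 u u := by
      rw [dirichletForm_one_self_eq k hu, add_comm]
      exact mul_le_mul_of_nonneg_left ((isH10_glue hu).two_mul_sq_apply_zero_le k) hc
    _ ≤ dirichletForm k ρm ρp u u := mul_dirichletForm_one_le hm hp u

end Glue

section Jump

theorem twoPhase_of_mem_lower {a b x : ℝ} (hx : x ∈ Ioo (-1 : ℝ) 0) : twoPhase a b x = b :=
  if_neg hx.2.not_gt

theorem twoPhase_of_mem_upper {a b x : ℝ} (hx : x ∈ Ioo (0 : ℝ) 1) : twoPhase a b x = a :=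
  if_pos hx.1

theorem tendsto_nhdsGT_of_eqOn {f : ℝ → ℝ} {F : smooth} {a b : ℝ} (hab : a < b)
    (h : EqOn f F (Ioo a b)) : Tendsto f (𝓝[>] a) (𝓝 (F a)) :=
  ((continuous_smooth F).tendsto a |>.mono_left nhdsWithin_le_nhds).congr'
    (h.symm.eventuallyEq_of_mem (Ioo_mem_nhdsGT hab))

theorem tendsto_nhdsLT_of_eqOn {f : ℝ → ℝ} {F : smooth} {a b : ℝ} (hab : a < b)
    (h : EqOn f F (Ioo a b)) : Tendsto f (𝓝[<] b) (𝓝 (F b)) :=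
  ((continuous_smooth F).tendsto b |>.mono_left nhdsWithin_le_nhds).congr'
    (h.symm.eventuallyEq_of_mem (Ioo_mem_nhdsLT hab))

theorem hasJump_iff_of_eqOn {f : ℝ → ℝ} {F G : smooth} {J : ℝ} (hm : EqOn f F (Ioo (-1) 0))
    (hp : EqOn f G (Ioo 0 1)) : HasJump f J ↔ J = G 0 - F 0 := by
  have hupper := tendsto_nhdsGT_of_eqOn one_pos hp
  have hlower := tendsto_nhdsLT_of_eqOn (by norm_num) hm
  constructor
  · rintro ⟨a, b, ha, hb, rfl⟩
    rw [tendsto_nhds_unique ha hupper, tendsto_nhds_unique hb hlower]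
  · exact fun h => ⟨_, _, hupper, hlower, h⟩

theorem eqOn_iteratedDeriv_D_pow {f : ℝ → ℝ} {F : smooth} {s : Set ℝ} (hs : IsOpen s)
    (h : EqOn f F s) (n : ℕ) : EqOn (iteratedDeriv n f) ((D ^ n) F) s :=
  coe_D_pow n F ▸ h.iteratedDeriv_of_isOpen hs n

variable {ψ : ℝ → ℝ} {u : smooth × smooth} {J : ℝ}

theorem hasJump_deriv_iff (hm : EqOn ψ u.1 (Ioo (-1) 0)) (hp : EqOn ψ u.2 (Ioo 0 1)) :
    HasJump (deriv ψ) J ↔ J = D u.2 0 - D u.1 0 :=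
  hasJump_iff_of_eqOn (hm.deriv isOpen_Ioo) (hp.deriv isOpen_Ioo)

theorem hasJump_momentum_iff (hm : EqOn ψ u.1 (Ioo (-1) 0)) (hp : EqOn ψ u.2 (Ioo 0 1))
    (ρm ρp l : ℝ) : HasJump (fun x => l ^ 2 * twoPhase ρp ρm x * deriv ψ x) J ↔
      J = l ^ 2 * ρp * D u.2 0 - l ^ 2 * ρm * D u.1 0 :=
  hasJump_iff_of_eqOn (F := (l ^ 2 * ρm) • D u.1) (G := (l ^ 2 * ρp) • D u.2)
    (fun x hx => by simp [twoPhase_of_mem_lower hx, hm.deriv isOpen_Ioo hx, coe_D])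
    (fun x hx => by simp [twoPhase_of_mem_upper hx, hp.deriv isOpen_Ioo hx, coe_D])

theorem hasJump_tangentialStress_iff (hm : EqOn ψ u.1 (Ioo (-1) 0)) (hp : EqOn ψ u.2 (Ioo 0 1))
    (μm μp l k : ℝ) :
    HasJump (fun x => twoPhase μp μm x * l * (k ^ 2 * ψ x + iteratedDeriv 2 ψ x)) J ↔
      J = μp * l * (k ^ 2 * u.2 0 + (D ^ 2) u.2 0) - μm * l * (k ^ 2 * u.1 0 + (D ^ 2) u.1 0) :=
  hasJump_iff_of_eqOn (F := (μm * l) • (k ^ 2 • u.1 + (D ^ 2) u.1))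
    (G := (μp * l) • (k ^ 2 • u.2 + (D ^ 2) u.2))
    (fun x hx => by
      simp [twoPhase_of_mem_lower hx, hm hx, eqOn_iteratedDeriv_D_pow isOpen_Ioo hm 2 hx,
        mul_add])
    (fun x hx => by
      simp [twoPhase_of_mem_upper hx, hp hx, eqOn_iteratedDeriv_D_pow isOpen_Ioo hp 2 hx,
        mul_add])

theorem hasJump_normalStress_iff (hm : EqOn ψ u.1 (Ioo (-1) 0)) (hp : EqOn ψ u.2 (Ioo 0 1))
    (μm μp l k : ℝ) :
    HasJump (fun x => twoPhase μp μm x * l * (iteratedDeriv 3 ψ x - 3 * k ^ 2 * deriv ψ x)) J ↔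
      J = μp * l * ((D ^ 3) u.2 0 - 3 * k ^ 2 * D u.2 0) -
        μm * l * ((D ^ 3) u.1 0 - 3 * k ^ 2 * D u.1 0) :=
  hasJump_iff_of_eqOn (F := (μm * l) • ((D ^ 3) u.1 - (3 * k ^ 2) • D u.1))
    (G := (μp * l) • ((D ^ 3) u.2 - (3 * k ^ 2) • D u.2))
    (fun x hx => by
      simp [twoPhase_of_mem_lower hx, hm.deriv isOpen_Ioo hx, coe_D,
        eqOn_iteratedDeriv_D_pow isOpen_Ioo hm 3 hx])
    (fun x hx => by
      simp [twoPhase_of_mem_upper hx, hp.deriv isOpen_Ioo hx, coe_D,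
        eqOn_iteratedDeriv_D_pow isOpen_Ioo hp 3 hx])

end Jump

section NormalMode

variable {g ρm ρp μm μp B k l c ξ : ℝ} {ψ : ℝ → ℝ} {u v : smooth × smooth}

/-- The pair `u` is the response of the two fluids, at the growth rate `l` and the frequency `k`,
to a normal force `c` on the interface. -/
def IsModeResponse (ρm ρp μm μp B k l c : ℝ) (u : smooth × smooth) : Prop :=
  IsResponse (l ^ 2 * ρm + |B| ^ 2 * k ^ 2) (l ^ 2 * ρp + |B| ^ 2 * k ^ 2) (l * μm) (l * μp) k c u

theorem IsModeResponse.energy_eq (h : IsModeResponse ρm ρp μm μp B k l c u) (hv : v ∈ profiles) :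
    pencil (dirichletForm k ρm ρp) (viscousForm k μm μp) ((|B| ^ 2 * k ^ 2) • dirichletForm k 1 1) l
      u v = c * interfaceValue v := by
  have := IsResponse.energy_eq h hv
  rw [dirichletForm_add_mul, viscousForm_mul] at this
  rw [pencil, add_right_comm]
  exact this

theorem exists_isModeResponse (hρm : 0 < ρm) (hρp : 0 < ρp) (hμm : 0 < μm) (hμp : 0 < μp)
    (hk : k ≠ 0) (hl : 0 < l) (B c : ℝ) : ∃ u, IsModeResponse ρm ρp μm μp B k l c u :=
  exists_isResponse (by positivity) (by positivity) (mul_pos hl hμm) (mul_pos hl hμp) hk c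

theorem IsLayerSolution.normalMode_ode {μ ρ : ℝ} {F : smooth}
    (h : IsLayerSolution |ξ| (l ^ 2 * ρ + |B| ^ 2 * |ξ| ^ 2) (l * μ) F) (x : ℝ) :
    -l ^ 2 * ρ * (|ξ| ^ 2 * F x - (D ^ 2) F x) =
      μ * l * (|ξ| ^ 4 * F x - 2 * |ξ| ^ 2 * (D ^ 2) F x + (D ^ 4) F x) +
      |B| ^ 2 * (|ξ| ^ 2 * ξ ^ 2 * F x - ξ ^ 2 * (D ^ 2) F x) := by
  have hx : l * μ * ((D ^ 4) F x - 2 * |ξ| ^ 2 * (D ^ 2) F x + |ξ| ^ 4 * F x) +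
    (l ^ 2 * ρ + |B| ^ 2 * |ξ| ^ 2) * (|ξ| ^ 2 * F x - (D ^ 2) F x) = 0 :=
    congrArg (fun G : smooth => G x) h
  rw [← sq_abs ξ]
  linear_combination -hx

theorem exists_isLayerSolution_eqOn_Icc {α ν a b : ℝ} (hν : ν ≠ 0) (hab : a < b)
    {f : ℝ → ℝ} (hc : ContinuousOn f (Icc a b)) (hf : ContDiffOn ℝ 4 f (Ioo a b))
    (hode : ∀ x ∈ Ioo a b,
      ν * (iteratedDeriv 4 f x - 2 * k ^ 2 * iteratedDeriv 2 f x + k ^ 4 * f x) +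
        α * (k ^ 2 * f x - iteratedDeriv 2 f x) = 0) :
    ∃ F, IsLayerSolution k α ν F ∧ EqOn f F (Icc a b) := by
  obtain ⟨F, hF, hfF⟩ := exists_isLayerSolution_eqOn hν hab hf hode
  exact ⟨F, hF, hfF.of_subset_closure hc (continuous_smooth F).continuousOn Ioo_subset_Icc_self
    (closure_Ioo hab.ne).ge⟩

theorem IsNormalMode.exists_isModeResponse (h : IsNormalMode g ρp ρm μp μm B ξ l ψ) (hμm : μm ≠ 0)
    (hμp : μp ≠ 0) (hl : l ≠ 0) :
    ∃ u, IsModeResponse ρm ρp μm μp B |ξ| l (g * (ρp - ρm) * |ξ| ^ 2 * ψ 0) u ∧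
      EqOn ψ (glue u) (Icc (-1) 1) := by
  obtain ⟨F, hF, hψF⟩ := exists_isLayerSolution_eqOn_Icc (k := |ξ|)
    (α := l ^ 2 * ρm + |B| ^ 2 * |ξ| ^ 2) (mul_ne_zero hl hμm) (by norm_num)
    (h.continuousOn.mono (Icc_subset_Icc_right zero_le_one)) h.contDiffOn_lower fun x hx => by
      have := h.ode x (Or.inl hx)
      rw [twoPhase_of_mem_lower hx, twoPhase_of_mem_lower hx, ← sq_abs ξ] at this
      linear_combination -this
  obtain ⟨G, hG, hψG⟩ := exists_isLayerSolution_eqOn_Icc (k := |ξ|)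
    (α := l ^ 2 * ρp + |B| ^ 2 * |ξ| ^ 2) (mul_ne_zero hl hμp) (by norm_num)
    (h.continuousOn.mono (Icc_subset_Icc_left (by norm_num))) h.contDiffOn_upper fun x hx => by
      have := h.ode x (Or.inr hx)
      rw [twoPhase_of_mem_upper hx, twoPhase_of_mem_upper hx, ← sq_abs ξ] at this
      linear_combination -this
  have hm : EqOn ψ F (Ioo (-1) 0) := hψF.mono Ioo_subset_Icc_self
  have hp : EqOn ψ G (Ioo 0 1) := hψG.mono Ioo_subset_Icc_self
  have hFG : F 0 = G 0 := (hψF (by simp)).symm.trans (hψG (by simp))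
  have hDFG : 0 = D G 0 - D F 0 := (hasJump_deriv_iff (u := (F, G)) hm hp).1 h.jump_deriv
  have htwo := (hasJump_tangentialStress_iff (u := (F, G)) hm hp μm μp l |ξ|).1 h.jump_two
  obtain ⟨J, hJ, hthree⟩ := h.jump_three
  rw [hasJump_momentum_iff (u := (F, G)) hm hp] at hJ
  rw [hasJump_normalStress_iff (u := (F, G)) hm hp, hJ] at hthree
  refine ⟨(F, G), ⟨⟨?_, ?_, ?_, ?_, hFG, by linarith⟩, hF, hG, ?_, ?_⟩, fun x hx => ?_⟩
  · rw [← hψF (by simp), h.left]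
  · exact tendsto_nhds_unique (tendsto_nhdsGT_of_eqOn (by norm_num) (hm.deriv isOpen_Ioo))
      h.deriv_left
  · rw [← hψG (by simp), h.right]
  · exact tendsto_nhds_unique (tendsto_nhdsLT_of_eqOn (by norm_num) (hp.deriv isOpen_Ioo))
      h.deriv_right
  · linear_combination -htwo
  · linear_combination -hthree - l ^ 2 * ρm * hDFG
  · rcases le_total x 0 with hx0 | hx0
    · exact (hψF ⟨hx.1, hx0⟩).trans (eqOn_glue_lower (F, G) hx0).symm
    · exact (hψG ⟨hx0, hx.2⟩).trans (eqOn_glue_upper (u := (F, G)) hFG hx0).symm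

theorem IsModeResponse.isNormalMode_glue
    (h : IsModeResponse ρm ρp μm μp B |ξ| l (g * (ρp - ρm) * |ξ| ^ 2 * interfaceValue u) u) :
    IsNormalMode g ρp ρm μp μm B ξ l (glue u) := by
  obtain ⟨⟨hleft, hDleft, hright, hDright, h0, hD0⟩, hlower, hupper, htwo, hthree⟩ := h
  have hm : EqOn (glue u) u.1 (Ioo (-1) 0) := (eqOn_glue_lower u).mono fun x hx => hx.2.le
  have hp : EqOn (glue u) u.2 (Ioo 0 1) := (eqOn_glue_upper h0).mono fun x hx => hx.1.le
  exact
  { continuousOn := (continuous_glue h0).continuousOn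
    contDiffOn_lower := (contDiff_infty.1 (contDiff_smooth u.1) 4).contDiffOn.congr hm
    contDiffOn_upper := (contDiff_infty.1 (contDiff_smooth u.2) 4).contDiffOn.congr hp
    ode := by
      rintro x (hx | hx)
      · rw [twoPhase_of_mem_lower hx, twoPhase_of_mem_lower hx, hm hx,
          eqOn_iteratedDeriv_D_pow isOpen_Ioo hm 2 hx, eqOn_iteratedDeriv_D_pow isOpen_Ioo hm 4 hx]
        exact hlower.normalMode_ode x
      · rw [twoPhase_of_mem_upper hx, twoPhase_of_mem_upper hx, hp hx,
          eqOn_iteratedDeriv_D_pow isOpen_Ioo hp 2 hx, eqOn_iteratedDeriv_D_pow isOpen_Ioo hp 4 hx]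
        exact hupper.normalMode_ode x
    jump_deriv := (hasJump_deriv_iff hm hp).2 (by rw [hD0, sub_self])
    jump_two := (hasJump_tangentialStress_iff hm hp ..).2 (by linear_combination -htwo)
    jump_three := ⟨_, (hasJump_momentum_iff hm hp ..).2 rfl, (hasJump_normalStress_iff hm hp ..).2
      (by rw [glue_apply_zero h0]; linear_combination -hthree - l ^ 2 * ρm * hD0)⟩
    left := (eqOn_glue_lower u (by simp)).trans hleft
    right := (eqOn_glue_upper h0 (by simp)).trans hright
    deriv_left := hDleft ▸ tendsto_nhdsGT_of_eqOn (by norm_num) (hm.deriv isOpen_Ioo)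
    deriv_right := hDright ▸ tendsto_nhdsLT_of_eqOn (by norm_num) (hp.deriv isOpen_Ioo) }

end NormalMode

section Stability

variable {g ρm ρp μm μp B k l ξ : ℝ} {ψ : ℝ → ℝ} {u : smooth × smooth}

theorem dirichletForm_one_self_pos (hu : u ∈ profiles) (hn : Nontriv (glue u)) :
    0 < dirichletForm k 1 1 u u := by
  have := (isH10_glue hu).integral_sq_deriv_pos hn
  have := (isH10_glue hu).integral_sq_pos hn
  rw [dirichletForm_one_self_eq k hu]
  positivity

theorem IsModeResponse.energy_lt
    (h : IsModeResponse ρm ρp μm μp B k l (g * (ρp - ρm) * k ^ 2 * interfaceValue u) u)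
    (hρm : 0 < ρm) (hρp : 0 < ρp) (hμm : 0 ≤ μm) (hμp : 0 ≤ μp) (hl : 0 < l)
    (hn : Nontriv (glue u)) :
    |B| ^ 2 * dirichletForm k 1 1 u u < g * (ρp - ρm) * interfaceValue u ^ 2 := by
  have hu : u ∈ profiles := h.mem_profiles
  have hkinetic : 0 < l ^ 2 * dirichletForm k ρm ρp u u :=
    mul_pos (pow_pos hl 2) ((mul_pos (lt_min hρm hρp) (dirichletForm_one_self_pos hu hn)).trans_le
      (mul_dirichletForm_one_le (min_le_left _ _) (min_le_right _ _) u))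
  have hviscous : 0 ≤ l * viscousForm k μm μp u u :=
    mul_nonneg hl.le ((isPosSemidef_viscousForm k hμm hμp).isNonneg.nonneg u)
  have henergy := h.energy_eq hu
  rw [pencil_apply, LinearMap.smul_apply, LinearMap.smul_apply, smul_eq_mul] at henergy
  refine lt_of_mul_lt_mul_left ?_ (sq_nonneg k)
  linear_combination henergy + hkinetic + hviscous

theorem Nontriv.congr {χ : ℝ → ℝ} (hn : Nontriv ψ) (h : EqOn ψ χ (Icc (-1) 1)) : Nontriv χ :=
  let ⟨x, hx, hψ⟩ := hn
  ⟨x, hx, h (Ioo_subset_Icc_self hx) ▸ hψ⟩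

theorem IsNormalMode.exists_energy_lt (h : IsNormalMode g ρp ρm μp μm B ξ l ψ) (hn : Nontriv ψ)
    (hρm : 0 < ρm) (hρp : 0 < ρp) (hμm : 0 < μm) (hμp : 0 < μp) (hl : 0 < l) :
    ∃ χ φ : ℝ → ℝ, IsH10 χ φ ∧ Nontriv χ ∧
      |B| ^ 2 * (∫ x in Ioo (-1 : ℝ) 1, φ x ^ 2) +
        |ξ| ^ 2 * (|B| ^ 2 * ∫ x in Ioo (-1 : ℝ) 1, χ x ^ 2) < g * (ρp - ρm) * χ 0 ^ 2 := by
  obtain ⟨u, hu, hψu⟩ := h.exists_isModeResponse hμm.ne' hμp.ne' hl.ne'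
  have hmem : u ∈ profiles := hu.mem_profiles
  have hvalue := glue_apply_zero hmem.2.2.2.2.1
  rw [hψu (by norm_num), hvalue] at hu
  have hlt := hu.energy_lt hρm hρp hμm.le hμp.le hl (hn.congr hψu)
  rw [dirichletForm_one_self_eq _ hmem, ← hvalue] at hlt
  exact ⟨_, _, isH10_glue hmem, hn.congr hψu, by linear_combination hlt⟩

theorem IsNormalMode.abs_lt_criticalB (h : IsNormalMode g ρp ρm μp μm B ξ l ψ) (hn : Nontriv ψ)
    (hρm : 0 < ρm) (hρp : 0 < ρp) (hμm : 0 < μm) (hμp : 0 < μp) (hl : 0 < l) :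
    |B| < criticalB g (ρp - ρm) := by
  obtain ⟨χ, φ, hχ, hnχ, hlt⟩ := h.exists_energy_lt hn hρm hρp hμm hμp hl
  have hmass : 0 ≤ |ξ| ^ 2 * (|B| ^ 2 * ∫ x in Ioo (-1 : ℝ) 1, χ x ^ 2) := by
    have := hχ.integral_sq_pos hnχ
    positivity
  have hle := hχ.le_criticalB hnχ g (ρp - ρm)
  exact lt_of_pow_lt_pow_left₀ 2 (Real.sqrt_nonneg _)
    (lt_of_mul_lt_mul_right (by linarith) (hχ.integral_sq_deriv_pos hnχ).le)

theorem IsNormalMode.abs_lt_criticalFreqH (h : IsNormalMode g ρp ρm μp μm B ξ l ψ)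
    (hn : Nontriv ψ) (hB : B ≠ 0) (hρm : 0 < ρm) (hρp : 0 < ρp) (hμm : 0 < μm) (hμp : 0 < μp)
    (hl : 0 < l) : |ξ| < criticalFreqH g (ρp - ρm) B := by
  obtain ⟨χ, φ, hχ, hnχ, hlt⟩ := h.exists_energy_lt hn hρm hρp hμm hμp hl
  have hle := hχ.le_criticalFreqH hnχ hB g (ρp - ρm)
  have hmass : 0 ≤ |B| ^ 2 * ∫ x in Ioo (-1 : ℝ) 1, χ x ^ 2 := by
    have := hχ.integral_sq_pos hnχ
    positivity
  exact lt_of_pow_lt_pow_left₀ 2 (Real.sqrt_nonneg _)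
    (lt_of_mul_lt_mul_right (by linarith) hmass)

end Stability

section Existence

variable {g j ρm ρp μm μp B k : ℝ}

theorem glue_diag (F : smooth) : glue (F, F) = F := funext fun _ => ite_self _

theorem diag_mem_profiles (χ : 𝓓(ioo (-1) 1, ℝ)) :
    ((⟨χ, χ.contDiff⟩, ⟨χ, χ.contDiff⟩) : smooth × smooth) ∈ profiles := by
  have hχ {x : ℝ} (hx : x ∉ Ioo (-1 : ℝ) 1) : χ x = 0 := testFunction_apply_eq_zero χ hx
  have hDχ {x : ℝ} (hx : x ∉ Ioo (-1 : ℝ) 1) : deriv χ x = 0 :=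
    Function.notMem_support.1 fun h => hx (χ.tsupport_subset (support_deriv_subset h))
  exact ⟨hχ (by simp), hDχ (by simp), hχ (by simp), hDχ (by simp), rfl, rfl⟩

theorem exists_profile_of_lt_criticalFreqH (hB : B ≠ 0) (hk : 0 < k)
    (hlt : k < criticalFreqH g j B) :
    ∃ v ∈ profiles, |B| ^ 2 * k ^ 2 * dirichletForm k 1 1 v v <
      g * j * k ^ 2 * interfaceValue v ^ 2 := by
  obtain ⟨χ, hχ⟩ := exists_testFunction_of_lt_criticalFreqH hB hk.le hlt
  refine ⟨_, diag_mem_profiles χ, ?_⟩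
  rw [dirichletForm_one_self_eq k (diag_mem_profiles χ), ← glue_apply_zero rfl, glue_diag,
    glue_diag, coe_D]
  linear_combination k ^ 2 * hχ

theorem exists_isModeResponse_interfaceValue (hρm : 0 < ρm) (hρp : 0 < ρp) (hμm : 0 < μm)
    (hμp : 0 < μp) (hB : B ≠ 0) (hk : 0 < k) (hlt : k < criticalFreqH g j B) :
    ∃ l u, 0 < l ∧ IsModeResponse ρm ρp μm μp B k l (g * j * k ^ 2 * interfaceValue u) u ∧
      interfaceValue u ≠ 0 := by
  have hresponse : ∀ l, 0 < l → ∃ u : profiles, IsModeResponse ρm ρp μm μp B k l 1 u :=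
    fun l hl =>
      let ⟨u, hu⟩ := exists_isModeResponse hρm hρp hμm hμp hk.ne' hl B 1
      ⟨⟨u, hu.mem_profiles⟩, hu⟩
  choose! u hu using hresponse
  let ι := profiles.subtype
  obtain ⟨v, hv, hvlt⟩ := exists_profile_of_lt_criticalFreqH hB hk hlt
  have hinertial : ((dirichletForm k ρm ρp).comp ι ι).IsPosSemidef :=
    isPosSemidef_comp (isPosSemidef_dirichletForm k hρm.le hρp.le) ι
  have hviscous : ((viscousForm k μm μp).comp ι ι).IsPosSemidef :=
    isPosSemidef_comp (isPosSemidef_viscousForm k hμm.le hμp.le) ι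
  have hmagnetic : (((|B| ^ 2 * k ^ 2) • dirichletForm k 1 1).comp ι ι).IsPosSemidef :=
    isPosSemidef_comp ((isPosSemidef_dirichletForm k zero_le_one zero_le_one).smul
      (by positivity)) ι
  obtain ⟨l, hl, hone⟩ := exists_mul_apply_representer_eq_one (T := interfaceValue ∘ₗ ι) (u := u)
    hinertial hviscous hmagnetic
    (fun l hl => LinearMap.ext fun v => ((hu l hl).energy_eq v.2).trans (one_mul _))
    (by positivity : 0 < min ρm ρp * (2 * k))
    (fun v => mul_interfaceValue_sq_le_dirichletForm (lt_min hρm hρp).le (min_le_left _ _)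
      (min_le_right _ _) v.2)
    ⟨⟨v, hv⟩, hvlt⟩
  replace hone : g * j * k ^ 2 * interfaceValue (u l : smooth × smooth) = 1 := hone
  exact ⟨l, u l, hl, hone.symm ▸ hu l hl, fun h0 => by simp [h0] at hone⟩

theorem exists_isNormalMode (hρm : 0 < ρm) (hρp : 0 < ρp) (hμm : 0 < μm) (hμp : 0 < μp)
    (hB : B ≠ 0) (hk : 0 < k) (hlt : k < criticalFreqH g (ρp - ρm) B) :
    ∃ (l : ℝ) (ψ : ℝ → ℝ), 0 < l ∧ (∀ ξ, |ξ| = k → IsNormalMode g ρp ρm μp μm B ξ l ψ) ∧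
      ContDiffOn ℝ ∞ ψ (Ioo (-1) 0) ∧ ContDiffOn ℝ ∞ ψ (Ioo 0 1) ∧ ψ 0 ≠ 0 := by
  obtain ⟨l, u, hl, hu, hne⟩ := exists_isModeResponse_interfaceValue hρm hρp hμm hμp hB hk hlt
  have h0 : u.1 0 = u.2 0 := hu.mem_profiles.2.2.2.2.1
  refine ⟨l, glue u, hl, ?_, ?_, ?_, glue_apply_zero h0 ▸ hne⟩
  · rintro ξ rfl
    exact hu.isNormalMode_glue
  · exact (contDiff_smooth u.1).contDiffOn.congr
      ((eqOn_glue_lower u).mono fun x hx => hx.2.le)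
  · exact (contDiff_smooth u.2).contDiffOn.congr
      ((eqOn_glue_upper h0).mono fun x hx => hx.1.le)

end Existence

end

end RayleighTaylorMHD

theorem theorem2p2_general (g ρp ρm μp μm B : ℝ) (hρm : 0 < ρm) (hρp : 0 < ρp) (hμp : 0 < μp)
    (hμm : 0 < μm) (hB : B ≠ 0) :
    (RayleighTaylorMHD.criticalB g (ρp - ρm) ≤ |B| →
      ∀ ξ : ℝ, ¬ ∃ (lam : ℝ) (ψ : ℝ → ℝ), 0 < lam ∧ RayleighTaylorMHD.Nontriv ψ ∧
        RayleighTaylorMHD.IsNormalMode g ρp ρm μp μm B ξ lam ψ) ∧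
    (|B| < RayleighTaylorMHD.criticalB g (ρp - ρm) →
      ∀ ξ : ℝ, RayleighTaylorMHD.criticalFreqH g (ρp - ρm) B ≤ |ξ| →
        ¬ ∃ (lam : ℝ) (ψ : ℝ → ℝ), 0 < lam ∧ RayleighTaylorMHD.Nontriv ψ ∧
          RayleighTaylorMHD.IsNormalMode g ρp ρm μp μm B ξ lam ψ) ∧
    (|B| < RayleighTaylorMHD.criticalB g (ρp - ρm) →
      ∃ (lam : ℝ → ℝ) (ψ : ℝ → ℝ → ℝ),
        ∀ ξ : ℝ, 0 < |ξ| → |ξ| < RayleighTaylorMHD.criticalFreqH g (ρp - ρm) B →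
          0 < lam ξ ∧
          RayleighTaylorMHD.IsNormalMode g ρp ρm μp μm B ξ (lam ξ) (ψ ξ) ∧
          lam (-ξ) = lam ξ ∧ ψ (-ξ) = ψ ξ ∧
          ContDiffOn ℝ ∞ (ψ ξ) (Set.Ioo (-1) 0) ∧ ContDiffOn ℝ ∞ (ψ ξ) (Set.Ioo 0 1) ∧
          ψ ξ 0 ≠ 0) := by
  refine ⟨fun h ξ ⟨l, ψ, hl, hn, hψ⟩ => ?_, fun _ ξ h ⟨l, ψ, hl, hn, hψ⟩ => ?_, fun _ => ?_⟩
  · exact (hψ.abs_lt_criticalB hn hρm hρp hμm hμp hl).not_ge h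
  · exact (hψ.abs_lt_criticalFreqH hn hB hρm hρp hμm hμp hl).not_ge h
  · choose! l ψ hl using fun (k : ℝ) (hk : 0 < k) =>
      RayleighTaylorMHD.exists_isNormalMode (g := g) hρm hρp hμm hμp hB hk
    refine ⟨fun ξ => l |ξ|, fun ξ => ψ |ξ|, fun ξ hξ hlt => ?_⟩
    obtain ⟨hpos, hmode, hlower, hupper, hne⟩ := hl |ξ| hξ hlt
    exact ⟨hpos, hmode ξ rfl, congrArg l (abs_neg ξ), congrArg ψ (abs_neg ξ), hlower, hupper, hne⟩

theorem theorem2p2 (g ρp ρm μp μm B : ℝ) (hg : 0 < g) (hρm : 0 < ρm) (hρ : ρm < ρp)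
    (hμp : 0 < μp) (hμm : 0 < μm) (hB : B ≠ 0) :
    (RayleighTaylorMHD.criticalB g (ρp - ρm) ≤ |B| →
      ∀ ξ : ℝ, ¬ ∃ (lam : ℝ) (ψ : ℝ → ℝ), 0 < lam ∧ RayleighTaylorMHD.Nontriv ψ ∧
        RayleighTaylorMHD.IsNormalMode g ρp ρm μp μm B ξ lam ψ) ∧
    (|B| < RayleighTaylorMHD.criticalB g (ρp - ρm) →
      ∀ ξ : ℝ, RayleighTaylorMHD.criticalFreqH g (ρp - ρm) B ≤ |ξ| →
        ¬ ∃ (lam : ℝ) (ψ : ℝ → ℝ), 0 < lam ∧ RayleighTaylorMHD.Nontriv ψ ∧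
          RayleighTaylorMHD.IsNormalMode g ρp ρm μp μm B ξ lam ψ) ∧
    (|B| < RayleighTaylorMHD.criticalB g (ρp - ρm) →
      ∃ (lam : ℝ → ℝ) (ψ : ℝ → ℝ → ℝ),
        ∀ ξ : ℝ, 0 < |ξ| → |ξ| < RayleighTaylorMHD.criticalFreqH g (ρp - ρm) B →
          0 < lam ξ ∧
          RayleighTaylorMHD.IsNormalMode g ρp ρm μp μm B ξ (lam ξ) (ψ ξ) ∧
          lam (-ξ) = lam ξ ∧ ψ (-ξ) = ψ ξ ∧
          ContDiffOn ℝ ∞ (ψ ξ) (Set.Ioo (-1) 0) ∧ ContDiffOn ℝ ∞ (ψ ξ) (Set.Ioo 0 1) ∧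
          ψ ξ 0 ≠ 0) :=
  theorem2p2_general g ρp ρm μp μm B hρm (hρm.trans hρ) hμp hμm hB
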